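/- **Theorem 1.3 (Reconstruction).** Let $0<c<1$, $Z>0$, $Y=\frac{2cZ}{1+c}$ and $$A=\begin{bmatrix}1&0&0&0\\0&-1&0&0\\0&0&c&0\\0&0&0&-c\end{bmatrix},\qquad B=\frac12\begin{bmatrix}0&0&-1-c&-1+c\\0&0&1-c&1+c\\1+c&-1+c&0&0\\1-c&-1-c&0&0\end{bmatrix}.$$ Let $\beta\in\dot C^1[0,Z]=\{\beta\in C^1[0,Z]:\beta(0)=\beta'(0)=0\}$, and let $\mathbf m=(m_1,m_2,m_3,m_4)$ be a corresponding $C^1$ solution of $$\mathbf m_t=A\mathbf m_z+\beta B\mathbf m\ \text{ on } 0\le z\le t\le 2Z-z,\qquad m_2(0,t)=m_4(0,t)=0\ (0\le t\le 2Z),$$ $$m_1(z,z)=0,\quad m_3(z,z)=\tfrac{c-1}{2(c+1)}\beta(z),\quad m_4(z,z)=\tfrac{c+1}{2(c-1)}\beta(z)\quad(0\le z\le Z).$$ Let the data $\varphi(t)=m_1(0,t)$, $\psi(t)=m_3(0,t)$, $t\in[0,2Z]$, and a number $M$ with $\|\beta\|_{L^2[0,Y]}\le M$ be given. Then $\beta$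 on $[0,Y]$ is reconstructed from $c,Z,M,\varphi,\psi$ by the following procedure. Put $\epsilon=\frac{c(1-c)^3}{(1+c)^4}$ and $$E=\max\Big(1,\int_0^{2Z}(\varphi^2+c\,\psi^2)\,dt\Big)e^{4M\sqrt Y/(c\epsilon)},\qquad \kappa=\frac{8(1+c)^2}{(1-c)^2}E,\qquad \delta_*=\frac{c^2\epsilon^2}{256\,\kappa}>0,$$ $X_j=\min(j\delta_*,Y)$ and $N=\lceil Y/\delta_*\rceil$, so that $X_0=0$ and $X_N=Y$. Start with $\mathbf a^0(t)=(\varphi(t),0,\psi(t),0)$ and $b_0=0$. For $j=0,\dots,N-1$, given $\mathbf a^j$ on $[X_j,2Z-X_j/c]$ and $b_j$, let $$\mathcal B_j=\Big\{f\in C^1[X_j,X_{j+1}]: f(X_j)=b_j,\ \|f\|^2_{L^2[X_j,X_{j+1}]}\le\kappa\Big\},$$ and, for $f\in\mathcal B_j$, let $(Q_jf)(z)=\frac{2(c+1)}{c-1}h_3(z,z)$, where $\mathbf h$ is the $C^1$ solution of the linear sideways problem $$\mathbf h_t=A\mathbf h_z+fB\mathbf h\ \text{ on } D_j=\{X_j\le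 z\le X_{j+1},\ z\le t\le 2Z-z/c\},$$ $$h_3(z,z)=\tfrac{(c-1)^2}{(c+1)^2}h_4(z,z)\ \ (X_j\le z\le X_{j+1}),\qquad \mathbf h(X_j,t)=\mathbf a^j(t)\ \ (X_j\le t\le 2Z-X_j/c).$$ Let $\beta^{(j)}$ be the $C^1$ function on $[X_j,X_{j+1}]$ that is the $L^2$ limit of the iterates $Q_j^nf_0$, where $f_0(z)=b_j e^{-\frac{b_j^2}{2\kappa}(z-X_j)}$; let $\mathbf a^{j+1}=\mathbf h(X_{j+1},\cdot)$, where $\mathbf h$ is the solution of the sideways problem with $f=\beta^{(j)}$; and let $b_{j+1}=\beta^{(j)}(X_{j+1})$. This procedure is well defined and correct. For every $j<N$, $X_j<X_{j+1}$ and: 1. $\mathbf a^j(t)=\mathbf m(X_j,t)$ for $t\in[X_j,2Z-X_j/c]$, and $b_j=\beta(X_j)$; 2. for every $f\in\mathcal B_j$ the sideways problem has exactly one $C^1$ solution on $D_j$, and $Q_jf\in\mathcal B_j$; and for all $f,g\in\mathcal B_j$, $\|Q_jf-Q_jg\|^2_{L^2[X_j,X_{j+1}]}\le\frac12\|f-g\|^2_{L^2[X_j,X_{j+1}]}$;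 3. $f_0\in\mathcal B_j$, the restriction of $\beta$ to $[X_j,X_{j+1}]$ lies in $\mathcal B_j$ and satisfies $Q_j\beta=\beta$, and for every starting function $f\in\mathcal B_j$ and every $n\ge0$, $\|Q_j^nf-\beta\|^2_{L^2[X_j,X_{j+1}]}\le2^{-n}\|f-\beta\|^2_{L^2[X_j,X_{j+1}]}$; 4. $\beta^{(j)}=\beta$ on $[X_j,X_{j+1}]$, and the solution of the sideways problem on $D_j$ with $f=\beta^{(j)}$ is $\mathbf m$. Consequently the function on $[0,Y]$ glued from the $\beta^{(j)}$ equals $\beta$ on $[0,Y]$. -/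

import Mathlib

open Set Filter Topology

noncomputable section

namespace TwistRecon

/-- The matrix `A = diag(1, -1, c, -c)` of the propagation speeds. -/
def matA (c : ℝ) : Matrix (Fin 4) (Fin 4) ℝ :=
  !![1, 0, 0, 0;
     0, -1, 0, 0;
     0, 0, c, 0;
     0, 0, 0, -c]

/-- The (skew-symmetric) coupling matrix `B`. -/
def matB (c : ℝ) : Matrix (Fin 4) (Fin 4) ℝ :=
  (1 / 2 : ℝ) •
  !![0, 0, -1 - c, -1 + c;
     0, 0, 1 - c, 1 + c;
     1 + c, -1 + c, 0, 0;
     1 - c, -1 - c, 0, 0]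

/-- The depth `Y = 2cZ/(1+c)` up to which the twist is recovered. -/
def depth (c Z : ℝ) : ℝ := 2 * c * Z / (1 + c)

/-- The squared `L²[a,b]` norm (used for functions continuous on `[a,b]`). -/
def normSq (a b : ℝ) (f : ℝ → ℝ) : ℝ := ∫ z in a..b, f z ^ 2

/-- The `L²[a,b]` norm (used for functions continuous on `[a,b]`). -/
def l2Norm (a b : ℝ) (f : ℝ → ℝ) : ℝ := Real.sqrt (normSq a b f)

/-- The space of `C¹` functions on `[0,Z]` with `β(0) = β'(0) = 0`
(one-sided derivatives at the end points). -/
def CDotOne (Z : ℝ) : Set (ℝ → ℝ) :=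
  {β | ContDiffOn ℝ 1 β (Icc 0 Z) ∧ β 0 = 0 ∧ derivWithin β (Icc 0 Z) 0 = 0}

/-- `m_t = A m_z + β B m` at every point of the region `S`; points are pairs `(z,t)` and on the
boundary the derivatives are taken within `S`. -/
def SolvesSystem (c : ℝ) (S : Set (ℝ × ℝ)) (β : ℝ → ℝ) (m : ℝ × ℝ → Fin 4 → ℝ) : Prop :=
  ∀ p ∈ S, fderivWithin ℝ m S p (0, 1) =
    (matA c).mulVec (fderivWithin ℝ m S p (1, 0)) + β p.1 • (matB c).mulVec (m p)

/-- The closed triangle `0 ≤ z ≤ t ≤ 2Z - z`. -/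
def forwardRegion (Z : ℝ) : Set (ℝ × ℝ) :=
  {p | 0 ≤ p.1 ∧ p.1 ≤ p.2 ∧ p.2 ≤ 2 * Z - p.1}

/-- `m = (m₁, m₂, m₃, m₄)` (components indexed `0, 1, 2, 3`) is a `C¹` solution, on the triangle
`0 ≤ z ≤ t ≤ 2Z - z`, of the characteristic boundary value problem for the twist `β`. -/
structure IsForwardSolution (c Z : ℝ) (β : ℝ → ℝ) (m : ℝ × ℝ → Fin 4 → ℝ) : Prop where
  contDiffOn : ContDiffOn ℝ 1 m (forwardRegion Z)
  pde : SolvesSystem c (forwardRegion Z) β m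
  left₂ : ∀ t ∈ Icc 0 (2 * Z), m (0, t) 1 = 0
  left₄ : ∀ t ∈ Icc 0 (2 * Z), m (0, t) 3 = 0
  diag₁ : ∀ z ∈ Icc 0 Z, m (z, z) 0 = 0
  diag₃ : ∀ z ∈ Icc 0 Z, m (z, z) 2 = (c - 1) / (2 * (c + 1)) * β z
  diag₄ : ∀ z ∈ Icc 0 Z, m (z, z) 3 = (c + 1) / (2 * (c - 1)) * β z

/-- The slab `X ≤ z ≤ X'`, `z ≤ t ≤ 2Z - z/c`. -/
def slab (c Z X X' : ℝ) : Set (ℝ × ℝ) :=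
  {p | X ≤ p.1 ∧ p.1 ≤ X' ∧ p.1 ≤ p.2 ∧ p.2 ≤ 2 * Z - p.1 / c}

/-- `h` is a `C¹` solution, on the slab, of the linear sideways problem with coefficient `f` and
Cauchy data `a` on the side `z = X`. -/
structure IsSidewaysSolution (c Z X X' : ℝ) (a : ℝ → Fin 4 → ℝ) (f : ℝ → ℝ)
    (h : ℝ × ℝ → Fin 4 → ℝ) : Prop where
  contDiffOn : ContDiffOn ℝ 1 h (slab c Z X X')
  pde : SolvesSystem c (slab c Z X X') f h
  diag : ∀ z ∈ Icc X X', h (z, z) 2 = (c - 1) ^ 2 / (c + 1) ^ 2 * h (z, z) 3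
  side : ∀ t ∈ Icc X (2 * Z - X / c), h (X, t) = a t

/-- The solution of the sideways problem (meaningful on the slab when there is exactly one). -/
def sidewaysSolution (c Z X X' : ℝ) (a : ℝ → Fin 4 → ℝ) (f : ℝ → ℝ) : ℝ × ℝ → Fin 4 → ℝ :=
  Classical.epsilon (IsSidewaysSolution c Z X X' a f)

/-- The map `f ↦ (2(c+1)/(c-1)) h₃(z,z)`, where `h` solves the sideways problem with
coefficient `f`. -/
def updateMap (c Z X X' : ℝ) (a : ℝ → Fin 4 → ℝ) (f : ℝ → ℝ) : ℝ → ℝ :=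
  fun z => 2 * (c + 1) / (c - 1) * sidewaysSolution c Z X X' a f (z, z) 2

/-- The `C¹` functions on `[X,X']` with value `b` at `X` and squared `L²` norm at most `κ`. -/
def localBall (X X' b κ : ℝ) : Set (ℝ → ℝ) :=
  {f | ContDiffOn ℝ 1 f (Icc X X') ∧ f X = b ∧ normSq X X' f ≤ κ}

/-- A concrete element of `localBall X X' b κ`, used to start the iteration. -/
def initialGuess (X b κ : ℝ) : ℝ → ℝ :=
  fun z => b * Real.exp (-(b ^ 2 / (2 * κ)) * (z - X))

/-- The `C¹` function on `[X,X']` that is the `L²[X,X']` limit of the iterates of `updateMap`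
started at `initialGuess`. -/
def localReconstruction (c Z κ X X' : ℝ) (a : ℝ → Fin 4 → ℝ) (b : ℝ) : ℝ → ℝ :=
  Classical.epsilon fun r : ℝ → ℝ => ContDiffOn ℝ 1 r (Icc X X') ∧
    Tendsto (fun n : ℕ => normSq X X' ((updateMap c Z X X' a)^[n] (initialGuess X b κ) - r))
      atTop (𝓝 0)

/-- The grid points `min (j δ) Y`. -/
def grid (c Z δ : ℝ) (j : ℕ) : ℝ := min (j * δ) (depth c Z)

/-- The quantities `(𝐦(X_j, ·), β(X_j))` as computed from the data `φ, ψ`, marching through the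
grid `X_0 = 0, X_1, X_2, …`: on `[X_j, X_{j+1}]` the twist is computed by `localReconstruction`, and
the solution of the sideways problem for it then gives the quantities at `X_{j+1}`. -/
def stage (c Z δ κ : ℝ) (φ ψ : ℝ → ℝ) : ℕ → (ℝ → Fin 4 → ℝ) × ℝ
  | 0 => (fun t => ![φ t, 0, ψ t, 0], 0)
  | j + 1 =>
    let s := stage c Z δ κ φ ψ j
    let X := grid c Z δ j
    let X' := grid c Z δ (j + 1)
    let r := localReconstruction c Z κ X X' s.1 s.2
    (fun t => sidewaysSolution c Z X X' s.1 r (X', t), r X')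

/-- The piece of the reconstructed twist on the `j`-th grid interval. -/
def piece (c Z δ κ : ℝ) (φ ψ : ℝ → ℝ) (j : ℕ) : ℝ → ℝ :=
  localReconstruction c Z κ (grid c Z δ j) (grid c Z δ (j + 1))
    (stage c Z δ κ φ ψ j).1 (stage c Z δ κ φ ψ j).2

/-- The reconstructed twist, glued from the pieces. -/
def reconstruction (c Z δ κ : ℝ) (φ ψ : ℝ → ℝ) : ℝ → ℝ :=
  fun z => piece c Z δ κ φ ψ (⌈z / δ⌉₊ - 1) z

/-- The weight `ε = c(1-c)³/(1+c)⁴`. -/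
def weight (c : ℝ) : ℝ := c * (1 - c) ^ 3 / (1 + c) ^ 4

/-- An upper bound, computed from the data and from a bound `M` on the `L²[0,Y]` norm of the twist,
for the weighted energies of `𝐦` on the vertical lines. -/
def energyBound (c Z M : ℝ) (φ ψ : ℝ → ℝ) : ℝ :=
  max 1 (∫ t in (0 : ℝ)..2 * Z, (φ t ^ 2 + c * ψ t ^ 2)) *
    Real.exp (4 * (M * Real.sqrt (depth c Z)) / (c * weight c))

/-- The (squared) radius of the balls in which the local iterations take place. -/
def radius (c Z M : ℝ) (φ ψ : ℝ → ℝ) : ℝ :=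
  8 * (1 + c) ^ 2 / (1 - c) ^ 2 * energyBound c Z M φ ψ

/-- The uniform step size. -/
def stepSize (c Z M : ℝ) (φ ψ : ℝ → ℝ) : ℝ :=
  c ^ 2 * weight c ^ 2 / (256 * radius c Z M φ ψ)

end TwistRecon

end

open TwistRecon

/-!
Reconstruction of the twist by marching in depth.

Read with `z` as the evolution variable, the system `h_t = A h_z + f B h` is hyperbolic with
characteristics of slopes `∓1, ∓1/c`. On a slab `X ≤ z ≤ X'`, `z ≤ t ≤ 2Z - z/c` no characteristic
enters through the upper edge, and only the fourth family enters through the diagonal, where the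
boundary condition prescribes `h₄` in terms of `h₃`. The true field `m` solves this problem for
`f = β`, because its two diagonal conditions have the required ratio, and then
`β = 2 (c+1)/(c-1) m₃` on the diagonal: `β` is a fixed point of the update map.

*Energy.* Weight the squares of the components with `1, 1, c, c ε`, integrate over the segments `z =
const` and differentiate in `z`. The flux through the upper edge has a good sign, and `ε = weight c`
is exactly such that the flux through the diagonal dominates `∫ h₃(z,z)² dz` (`diag_boundary`,
`energy_le`).
With Gronwall's inequality this bounds the energy and the diagonal trace of a solution by the
energy of its side data times `exp (4 ‖f‖₁ / (c ε))` (`energy_growth`). Applied to `m` on `[0, Y]`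
it gives the a priori bound `E`, hence `‖β‖² ≤ κ` (`forward_energy_le`, `normSq_twist_le`). On a
short slab, where `‖f‖₁ ≤ c ε / 16` for every `f` in the ball, it gives `‖Q f‖² ≤ κ`. The same
estimate for the difference of two solutions, in which `(f - g) B h` acts as a source, gives the
contraction and uniqueness (`energy_difference`, `IsStep.contraction`, `IsStep.unique`).

*Existence.* The linear sideways problem is extended to the whole plane and integrated along the
characteristics (`transport`). As `f` is small in `L¹`, the resulting map is a contraction in the
supremum norm, even after the reflection on the diagonal. The coefficient does not depend on `t`,
so `v = ∂h/∂t` satisfies an equation of the same type, whose boundary condition also contains `h`;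
the map for the pair `(h, η v)` is a contraction for small `η`, and it preserves the closed set of
pairs in which `v` is the derivative of `h` (`exists_planar_solution`). The `z`-derivative then
comes from the system, so that `f` need only be continuous. For `v` to be continuous across the
characteristic issuing from the corner `(X, X)`, two compatibility conditions are needed there; they
involve `f` only through `f(X)`, so they are inherited from `m` (`corner_compatibility`).

*Marching.* On each grid interval the iterates converge to `β` and the sideways solution for the
limit is `m`, so that the next interval starts from true data (`stage_correct`).
-/

namespace TwistRecon

/-! ### Integration along characteristics -/

/-- The integral of `f g` with respect to `z` along the line of slope `dt/dz = σ` through `p`, from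
the abscissa `X` to the abscissa of `p`. -/
noncomputable def charInt (f : ℝ → ℝ) (σ X : ℝ) (g : ℝ × ℝ → ℝ) (p : ℝ × ℝ) : ℝ :=
  ∫ s in X..p.1, f s * g (s, p.2 - σ * (p.1 - s))

lemma charInt_continuous {f : ℝ → ℝ} {σ X : ℝ} {g : ℝ × ℝ → ℝ} (hf : Continuous f)
    (hg : Continuous g) : Continuous (charInt f σ X g) := by
  unfold charInt
  refine intervalIntegral.continuous_parametric_intervalIntegral_of_continuous ?_ continuous_fst
  simp only [Function.uncurry_def]
  fun_prop

lemma charInt_self (f : ℝ → ℝ) (σ X : ℝ) (g : ℝ × ℝ → ℝ) (t : ℝ) :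
    charInt f σ X g (X, t) = 0 := by
  simp [charInt]

lemma charInt_sub {f : ℝ → ℝ} {σ X : ℝ} {g g' : ℝ × ℝ → ℝ} (hf : Continuous f)
    (hg : Continuous g) (hg' : Continuous g') (p : ℝ × ℝ) :
    charInt f σ X g p - charInt f σ X g' p = charInt f σ X (fun q => g q - g' q) p := by
  unfold charInt
  rw [← intervalIntegral.integral_sub]
  · simp only [mul_sub]
  · exact (by fun_prop : Continuous _).intervalIntegrable _ _
  · exact (by fun_prop : Continuous _).intervalIntegrable _ _

lemma charInt_abs_le {f : ℝ → ℝ} {σ X γ H : ℝ} {g : ℝ × ℝ → ℝ} (hf : Continuous f)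
    (hγ : ∀ x y, |(∫ s in x..y, |f s|)| ≤ γ) (hg : ∀ p, |g p| ≤ H) (p : ℝ × ℝ) :
    |charInt f σ X g p| ≤ γ * H := by
  have hH : 0 ≤ H := (abs_nonneg _).trans (hg p)
  unfold charInt
  calc |∫ s in X..p.1, f s * g (s, p.2 - σ * (p.1 - s))|
      ≤ |(∫ s in X..p.1, |f s| * H)| := by
        have := intervalIntegral.norm_integral_le_abs_of_norm_le (μ := MeasureTheory.volume)
          (a := X) (b := p.1) (f := fun s => f s * g (s, p.2 - σ * (p.1 - s)))
          (g := fun s => |f s| * H)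
        simp only [Real.norm_eq_abs] at this
        refine this (Eventually.of_forall fun s => ?_) ?_
        · rw [abs_mul]
          exact mul_le_mul_of_nonneg_left (hg _) (abs_nonneg _)
        · exact (by fun_prop : Continuous _).intervalIntegrable _ _
    _ = |(∫ s in X..p.1, |f s|)| * H := by
        rw [intervalIntegral.integral_mul_const, abs_mul, abs_of_nonneg hH]
    _ ≤ γ * H := mul_le_mul_of_nonneg_right (hγ _ _) hH

/-- Differentiation under the integral sign along a moving line: no differentiability of `f`, nor
of `g` in the first variable, is needed. -/
lemma charInt_hasStrictFDerivAt {f : ℝ → ℝ} {σ X : ℝ} {g g' : ℝ × ℝ → ℝ} (hf : Continuous f)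
    (hg : Continuous g) (hg' : Continuous g')
    (hd : ∀ z t, HasDerivAt (fun t => g (z, t)) (g' (z, t)) t) (p : ℝ × ℝ) :
    HasStrictFDerivAt (charInt f σ X g)
      ((f p.1 * g p - σ * charInt f σ X g' p) • ContinuousLinearMap.fst ℝ ℝ ℝ +
        charInt f σ X g' p • ContinuousLinearMap.snd ℝ ℝ ℝ) p := by
  -- in the coordinates `(z, θ) = (z, t - σ z)` the lines are vertical and only the upper limit
  -- of integration moves
  set u : ℝ → ℝ → ℝ := fun z θ => ∫ s in X..z, f s * g (s, θ + σ * s) with hu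
  set u₁ : ℝ → ℝ → ℝ →L[ℝ] ℝ := fun z θ =>
    (f z * g (z, θ + σ * z)) • ContinuousLinearMap.id ℝ ℝ
  set u₂ : ℝ → ℝ → ℝ →L[ℝ] ℝ := fun z θ =>
    (∫ s in X..z, f s * g' (s, θ + σ * s)) • ContinuousLinearMap.id ℝ ℝ
  have h₁ : ∀ v : ℝ × ℝ, HasFDerivAt (u · v.2) ((↿u₁) v) v.1 := by
    rintro ⟨z, θ⟩
    have hc : Continuous fun s => f s * g (s, θ + σ * s) := by fun_prop
    have : HasDerivAt (fun z => ∫ s in X..z, f s * g (s, θ + σ * s)) (f z * g (z, θ + σ * z)) z :=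
      intervalIntegral.integral_hasDerivAt_right
        (hc.intervalIntegrable _ _) (hc.stronglyMeasurableAtFilter _ _) hc.continuousAt
    refine this.hasFDerivAt.congr_fderiv ?_
    ext
    simp [u₁, Function.HasUncurry.uncurry]
  have h₂ : ∀ v : ℝ × ℝ, HasFDerivAt (u v.1 ·) ((↿u₂) v) v.2 := by
    rintro ⟨z, θ⟩
    have hc : Continuous fun q : ℝ × ℝ => f q.2 * g' (q.2, q.1 + σ * q.2) := by fun_prop
    obtain ⟨C, hC⟩ := ((isCompact_Icc (a := θ - 1) (b := θ + 1)).prod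
      (isCompact_uIcc (a := X) (b := z))).exists_bound_of_continuousOn hc.continuousOn
    have := (intervalIntegral.hasDerivAt_integral_of_dominated_loc_of_deriv_le
      (μ := MeasureTheory.volume) (a := X) (b := z) (x₀ := θ) (s := Icc (θ - 1) (θ + 1))
      (F := fun θ s => f s * g (s, θ + σ * s)) (F' := fun θ s => f s * g' (s, θ + σ * s))
      (bound := fun _ => C)
      (Icc_mem_nhds (by linarith) (by linarith))
      (Eventually.of_forall fun x =>
        (by fun_prop : Continuous fun s => f s * g (s, x + σ * s)).aestronglyMeasurable)
      ((by fun_prop : Continuous fun s => f s * g (s, θ + σ * s)).intervalIntegrable _ _)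
      (by fun_prop : Continuous fun s => f s * g' (s, θ + σ * s)).aestronglyMeasurable
      (Eventually.of_forall fun s hs x hx => hC (x, s) ⟨hx, uIoc_subset_uIcc hs⟩)
      (by simp)
      (Eventually.of_forall fun s _ x _ => by
        have h := (hd s (x + σ * s)).comp_add_const x (σ * s)
        exact h.const_mul (f s))).2
    refine this.hasFDerivAt.congr_fderiv ?_
    ext
    simp [u₂, Function.HasUncurry.uncurry]
  have c₁ : Continuous ↿u₁ := by
    simp only [u₁, Function.HasUncurry.uncurry]
    fun_prop
  have c₂ : Continuous ↿u₂ := by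
    have : Continuous fun q : ℝ × ℝ => ∫ s in X..q.1, f s * g' (s, q.2 + σ * s) := by
      refine intervalIntegral.continuous_parametric_intervalIntegral_of_continuous ?_ continuous_fst
      simp only [Function.uncurry_def]
      fun_prop
    simp only [u₂, Function.HasUncurry.uncurry]
    exact this.smul continuous_const
  have key := hasStrictFDerivAt_uncurry_coprod (u := (p.1, p.2 - σ * p.1)) (f := u) (f₁ := u₁)
    (f₂ := u₂) (Eventually.of_forall h₁) (Eventually.of_forall h₂) c₁.continuousAt c₂.continuousAt
  have hlin : HasStrictFDerivAt (fun q : ℝ × ℝ => (q.1, q.2 - σ * q.1))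
      ((ContinuousLinearMap.fst ℝ ℝ ℝ).prod
        (ContinuousLinearMap.snd ℝ ℝ ℝ - σ • ContinuousLinearMap.fst ℝ ℝ ℝ)) p :=
    hasStrictFDerivAt_fst.prodMk (hasStrictFDerivAt_snd.sub (hasStrictFDerivAt_fst.const_mul σ))
  have hcomp := HasStrictFDerivAt.comp (g := ↿u) (f := fun q : ℝ × ℝ => (q.1, q.2 - σ * q.1)) p
    key hlin
  have hline : ∀ (k : ℝ × ℝ → ℝ) (q : ℝ × ℝ),
      charInt f σ X k q = ∫ s in X..q.1, f s * k (s, q.2 - σ * q.1 + σ * s) := by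
    intro k q
    unfold charInt
    congr 1
    ext s
    ring_nf
  have heq : charInt f σ X g = ↿u ∘ fun q : ℝ × ℝ => (q.1, q.2 - σ * q.1) := by
    funext q
    rw [hline]
    rfl
  rw [heq]
  refine hcomp.congr_fderiv ?_
  ext
  · simp [u₁, u₂, Function.HasUncurry.uncurry, hline g']
    ring
  · simp [u₁, u₂, Function.HasUncurry.uncurry, hline g']

/-! ### The system in integrated form -/

lemma matB_mulVec (c : ℝ) (x : Fin 4 → ℝ) : (matB c).mulVec x =
    ![((-1 - c) * x 2 + (-1 + c) * x 3) / 2, ((1 - c) * x 2 + (1 + c) * x 3) / 2,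
      ((1 + c) * x 0 + (-1 + c) * x 1) / 2, ((1 - c) * x 0 + (-1 - c) * x 1) / 2] := by
  ext i
  fin_cases i <;> simp [matB, Matrix.mulVec, dotProduct, Fin.sum_univ_four] <;> ring

lemma matA_mulVec (c : ℝ) (x : Fin 4 → ℝ) : (matA c).mulVec x =
    ![x 0, - x 1, c * x 2, - (c * x 3)] := by
  ext i
  fin_cases i <;> simp [matA, Matrix.mulVec, dotProduct, Fin.sum_univ_four]

/-- The slopes `dt/dz` of the four families of characteristics. -/
noncomputable def slope (c : ℝ) : Fin 4 → ℝ := ![-1, 1, -1 / c, 1 / c]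

/-- The `i`-th component of `-A⁻¹ B x`, the coupling term of the system solved for the
`z`-derivative. The slopes are the diagonal entries of `-A⁻¹`. -/
noncomputable def coupling (c : ℝ) (i : Fin 4) (x : Fin 4 → ℝ) : ℝ :=
  slope c i * (matB c).mulVec x i

lemma coupling_sub (c : ℝ) (i : Fin 4) (x y : Fin 4 → ℝ) :
    coupling c i (x - y) = coupling c i x - coupling c i y := by
  simp [coupling, Matrix.mulVec_sub, mul_sub]

@[fun_prop]
lemma continuous_coupling (c : ℝ) (i : Fin 4) : Continuous (coupling c i) := by
  unfold coupling
  fun_prop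

lemma hasDerivAt_coupling {u : ℝ → Fin 4 → ℝ} {u' : Fin 4 → ℝ} {t : ℝ} (c : ℝ) (i : Fin 4)
    (hu : HasDerivAt u u' t) : HasDerivAt (fun t => coupling c i (u t)) (coupling c i u') t := by
  have h := hasDerivAt_pi.1 hu
  simp only [coupling, matB_mulVec]
  refine HasDerivAt.const_mul _ ?_
  fin_cases i <;> simp <;>
  exact HasDerivAt.div_const (((h _).const_mul _).add ((h _).const_mul _)) _

lemma abs_coupling_le {c : ℝ} (hc₀ : 0 < c) (hc₁ : c < 1) (i : Fin 4) {x : Fin 4 → ℝ} {H : ℝ}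
    (hx : ∀ j, |x j| ≤ H) : |coupling c i x| ≤ H / c := by
  have h0 := abs_le.1 (hx 0)
  have h1 := abs_le.1 (hx 1)
  have h2 := abs_le.1 (hx 2)
  have h3 := abs_le.1 (hx 3)
  have hH : 0 ≤ H := (abs_nonneg _).trans (hx 0)
  have hHc : H ≤ H / c := by
    rw [le_div_iff₀ hc₀]
    nlinarith
  have hB : ∀ i, |(matB c).mulVec x i| ≤ H := by
    intro i
    rw [matB_mulVec]
    fin_cases i <;> simp <;> rw [abs_le] <;> constructor <;> nlinarith
  have hs : |slope c i| ≤ 1 / c := by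
    have : 1 ≤ 1 / c := by rw [le_div_iff₀ hc₀]; linarith
    fin_cases i <;> simp [slope, abs_div, abs_of_pos hc₀] <;> simpa using this
  calc |coupling c i x| = |slope c i| * |(matB c).mulVec x i| := abs_mul _ _
    _ ≤ 1 / c * H := mul_le_mul hs (hB i) (abs_nonneg _) (by positivity)
    _ = H / c := by ring

/-- The contribution of the coupling, accumulated along the `i`-th characteristic since the
line `z = X`. -/
noncomputable def duhamel (c X : ℝ) (f : ℝ → ℝ) (h : ℝ × ℝ → Fin 4 → ℝ) (i : Fin 4) :
    ℝ × ℝ → ℝ :=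
  charInt f (slope c i) X fun q => coupling c i (h q)

lemma duhamel_continuous {c X : ℝ} {f : ℝ → ℝ} {h : ℝ × ℝ → Fin 4 → ℝ} (hf : Continuous f)
    (hh : Continuous h) (i : Fin 4) : Continuous (duhamel c X f h i) :=
  charInt_continuous hf (by fun_prop)

lemma duhamel_self (c X : ℝ) (f : ℝ → ℝ) (h : ℝ × ℝ → Fin 4 → ℝ) (i : Fin 4) (t : ℝ) :
    duhamel c X f h i (X, t) = 0 := charInt_self _ _ _ _ _

lemma duhamel_abs_le {c X γ H : ℝ} {f : ℝ → ℝ} {h : ℝ × ℝ → Fin 4 → ℝ} (hc₀ : 0 < c) (hc₁ : c < 1)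
    (hf : Continuous f) (hγ : ∀ x y, |(∫ s in x..y, |f s|)| ≤ γ)
    (hH : ∀ p j, |h p j| ≤ H) (i : Fin 4) (p : ℝ × ℝ) :
    |duhamel c X f h i p| ≤ γ / c * H := by
  have := charInt_abs_le (σ := slope c i) (X := X) hf hγ
    (fun p => abs_coupling_le hc₀ hc₁ i (hH p)) p
  calc _ ≤ γ * (H / c) := this
    _ = γ / c * H := by ring

lemma duhamel_dist_le {c X γ H : ℝ} {f : ℝ → ℝ} {h h' : ℝ × ℝ → Fin 4 → ℝ} (hc₀ : 0 < c)
    (hc₁ : c < 1) (hf : Continuous f) (hγ : ∀ x y, |(∫ s in x..y, |f s|)| ≤ γ)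
    (hh : Continuous h) (hh' : Continuous h') (hH : ∀ p j, |h p j - h' p j| ≤ H) (i : Fin 4)
    (p : ℝ × ℝ) :
    |duhamel c X f h i p - duhamel c X f h' i p| ≤ γ / c * H := by
  have : duhamel c X f h i p - duhamel c X f h' i p = duhamel c X f (fun q => h q - h' q) i p := by
    unfold duhamel
    rw [charInt_sub hf (by fun_prop) (by fun_prop)]
    simp only [coupling_sub]
  rw [this]
  exact duhamel_abs_le hc₀ hc₁ hf hγ (fun p j => hH p j) i p

lemma duhamel_hasStrictFDerivAt {c X : ℝ} {f : ℝ → ℝ} {h v : ℝ × ℝ → Fin 4 → ℝ}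
    (hf : Continuous f) (hh : Continuous h) (hv : Continuous v)
    (hd : ∀ z t, HasDerivAt (fun t => h (z, t)) (v (z, t)) t) (i : Fin 4) (p : ℝ × ℝ) :
    HasStrictFDerivAt (duhamel c X f h i)
      ((f p.1 * coupling c i (h p) - slope c i * duhamel c X f v i p) •
        ContinuousLinearMap.fst ℝ ℝ ℝ +
        duhamel c X f v i p • ContinuousLinearMap.snd ℝ ℝ ℝ) p :=
  charInt_hasStrictFDerivAt hf (by fun_prop) (by fun_prop)
    (fun z t => hasDerivAt_coupling c i (hd z t)) p

/-- The function that carries the data `α` at `z = X` along the characteristics and adds the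
contribution of the coupling computed from `h`. Its fixed points solve the system. -/
noncomputable def transport (c X : ℝ) (f : ℝ → ℝ) (α : ℝ → Fin 4 → ℝ) (h : ℝ × ℝ → Fin 4 → ℝ)
    (p : ℝ × ℝ) (i : Fin 4) : ℝ :=
  α (p.2 - slope c i * (p.1 - X)) i + duhamel c X f h i p

lemma transport_continuous {c X : ℝ} {f : ℝ → ℝ} {α : ℝ → Fin 4 → ℝ} {h : ℝ × ℝ → Fin 4 → ℝ}
    (hf : Continuous f) (hα : Continuous α) (hh : Continuous h) :
    Continuous (transport c X f α h) := by
  refine continuous_pi fun i => ?_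
  have := duhamel_continuous (c := c) (X := X) hf hh i
  unfold transport
  fun_prop

lemma transport_abs_le {c X γ H D : ℝ} {f : ℝ → ℝ} {α : ℝ → Fin 4 → ℝ}
    {h : ℝ × ℝ → Fin 4 → ℝ} (hc₀ : 0 < c) (hc₁ : c < 1)
    (hf : Continuous f) (hγ : ∀ x y, |(∫ s in x..y, |f s|)| ≤ γ)
    (hH : ∀ p j, |h p j| ≤ H) (hα : ∀ θ j, |α θ j| ≤ D) (p : ℝ × ℝ) (i : Fin 4) :
    |transport c X f α h p i| ≤ D + γ / c * H :=
  (abs_add_le _ _).trans (add_le_add (hα _ _) (duhamel_abs_le hc₀ hc₁ hf hγ hH i p))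

lemma transport_dist_le {c X γ H D : ℝ} {f : ℝ → ℝ} {α α' : ℝ → Fin 4 → ℝ}
    {h h' : ℝ × ℝ → Fin 4 → ℝ} (hc₀ : 0 < c) (hc₁ : c < 1)
    (hf : Continuous f) (hγ : ∀ x y, |(∫ s in x..y, |f s|)| ≤ γ)
    (hh : Continuous h) (hh' : Continuous h') (hH : ∀ p j, |h p j - h' p j| ≤ H)
    (hα : ∀ θ j, |α θ j - α' θ j| ≤ D) (p : ℝ × ℝ) (i : Fin 4) :
    |transport c X f α h p i - transport c X f α' h' p i| ≤ D + γ / c * H := by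
  have : transport c X f α h p i - transport c X f α' h' p i =
      (α (p.2 - slope c i * (p.1 - X)) i - α' (p.2 - slope c i * (p.1 - X)) i) +
        (duhamel c X f h i p - duhamel c X f h' i p) := by
    unfold transport
    ring
  rw [this]
  exact (abs_add_le _ _).trans
    (add_le_add (hα _ _) (duhamel_dist_le hc₀ hc₁ hf hγ hh hh' hH i p))

/-- If `v = ∂h/∂t` then `transport` maps `(α, h)` to a `C¹` function whose `t`-derivative is
`transport` of `(α', v)`. -/
lemma transport_hasStrictFDerivAt {c X : ℝ} {f : ℝ → ℝ} {α α' : ℝ → Fin 4 → ℝ}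
    {h v : ℝ × ℝ → Fin 4 → ℝ} (hf : Continuous f) (hh : Continuous h) (hv : Continuous v)
    (hd : ∀ z t, HasDerivAt (fun t => h (z, t)) (v (z, t)) t)
    (hα : ∀ t, HasDerivAt α (α' t) t) (hα' : Continuous α') (p : ℝ × ℝ) (i : Fin 4) :
    HasStrictFDerivAt (fun p => transport c X f α h p i)
      ((f p.1 * coupling c i (h p) - slope c i * transport c X f α' v p i) •
        ContinuousLinearMap.fst ℝ ℝ ℝ +
        transport c X f α' v p i • ContinuousLinearMap.snd ℝ ℝ ℝ) p := by
  have hlin : HasStrictFDerivAt (fun q : ℝ × ℝ => q.2 - slope c i * (q.1 - X))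
      (ContinuousLinearMap.snd ℝ ℝ ℝ - slope c i • ContinuousLinearMap.fst ℝ ℝ ℝ) p :=
    hasStrictFDerivAt_snd.sub ((hasStrictFDerivAt_fst.sub_const X).const_mul (slope c i))
  have hαi : HasStrictDerivAt (fun t => α t i) (α' (p.2 - slope c i * (p.1 - X)) i)
      (p.2 - slope c i * (p.1 - X)) :=
    hasStrictDerivAt_of_hasDerivAt_of_continuousAt
      (f' := fun t => α' t i) (Eventually.of_forall fun t => hasDerivAt_pi.1 (hα t) i)
      (by fun_prop)
  have h1 := HasStrictDerivAt.comp_hasStrictFDerivAt p hαi hlin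
  have h2 := duhamel_hasStrictFDerivAt (c := c) (X := X) hf hh hv hd i p
  refine (h1.add h2).congr_fderiv ?_
  ext
  · simp [transport]
    ring
  · simp [transport]

/-! ### The boundary condition on the diagonal -/

/-- The function with components `A θ i`, except that the last one is replaced by `r θ` on
`θ < X`. -/
noncomputable def glue (X : ℝ) (A : ℝ → Fin 4 → ℝ) (r : ℝ → ℝ) (θ : ℝ) (i : Fin 4) : ℝ :=
  if i = 3 then (if X ≤ θ then A θ 3 else r θ) else A θ i

lemma glue_of_le {X θ : ℝ} (A : ℝ → Fin 4 → ℝ) (r : ℝ → ℝ) (hθ : X ≤ θ) :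
    glue X A r θ = A θ := by
  ext i
  by_cases hi : i = 3
  · subst hi
    simp [glue, hθ]
  · simp [glue, hi]

lemma glue_last_of_le {X θ : ℝ} (A : ℝ → Fin 4 → ℝ) {r : ℝ → ℝ} (hr : r X = A X 3)
    (hθ : θ ≤ X) : glue X A r θ 3 = r θ := by
  rcases hθ.lt_or_eq with h | h
  · simp [glue, not_le.2 h]
  · simp [glue, h, hr]

lemma glue_continuous {X : ℝ} {A : ℝ → Fin 4 → ℝ} {r : ℝ → ℝ} (hA : Continuous A)
    (hr : Continuous r) (h : r X = A X 3) : Continuous (glue X A r) := by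
  refine continuous_pi fun i => ?_
  unfold glue
  by_cases hi : i = 3
  · simp only [hi, if_true]
    refine Continuous.if_le (by fun_prop) hr continuous_const continuous_id ?_
    rintro x rfl
    exact h.symm
  · simp only [hi, if_false]
    fun_prop

lemma glue_abs_le {X D : ℝ} {A : ℝ → Fin 4 → ℝ} {r : ℝ → ℝ} (hA : ∀ θ i, |A θ i| ≤ D)
    (hr : ∀ θ, |r θ| ≤ D) (θ : ℝ) (i : Fin 4) : |glue X A r θ i| ≤ D := by
  unfold glue
  split_ifs
  exacts [hA _ _, hr _, hA _ _]

lemma glue_dist_le {X D : ℝ} {A : ℝ → Fin 4 → ℝ} {r r' : ℝ → ℝ}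
    (hr : ∀ θ, |r θ - r' θ| ≤ D) (θ : ℝ) (i : Fin 4) :
    |glue X A r θ i - glue X A r' θ i| ≤ D := by
  have hD : 0 ≤ D := (abs_nonneg _).trans (hr 0)
  unfold glue
  split_ifs
  exacts [by simpa, hr _, by simpa]

lemma glue_hasDerivAt {X : ℝ} {A A' : ℝ → Fin 4 → ℝ} {r r' : ℝ → ℝ}
    (hA : ∀ t, HasDerivAt A (A' t) t) (hr : ∀ t, HasDerivAt r (r' t) t)
    (h : r X = A X 3) (h' : r' X = A' X 3) (t : ℝ) :
    HasDerivAt (glue X A r) (glue X A' r' t) t := by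
  refine hasDerivAt_pi.2 fun i => ?_
  have hAi := hasDerivAt_pi.1 (hA t) i
  by_cases hi : i = 3
  · subst hi
    rcases lt_trichotomy t X with ht | ht | ht
    · rw [glue_last_of_le A' h' ht.le]
      refine (hr t).congr_of_eventuallyEq ?_
      filter_upwards [Iio_mem_nhds ht] with s hs
      exact glue_last_of_le A h (le_of_lt hs)
    · subst ht
      rw [glue_of_le A' r' le_rfl]
      have hR : HasDerivWithinAt (fun s => glue t A r s 3) (A' t 3) (Ici t) t :=
        hAi.hasDerivWithinAt.congr (fun s hs => by rw [glue_of_le A r hs])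
          (by rw [glue_of_le A r le_rfl])
      have hL : HasDerivWithinAt (fun s => glue t A r s 3) (A' t 3) (Iic t) t := by
        rw [← h']
        exact (hr t).hasDerivWithinAt.congr (fun s hs => glue_last_of_le A h hs)
          (glue_last_of_le A h le_rfl)
      simpa using hL.union hR
    · rw [glue_of_le A' r' ht.le]
      refine hAi.congr_of_eventuallyEq ?_
      filter_upwards [Ioi_mem_nhds ht] with s hs
      rw [glue_of_le A r (le_of_lt hs)]
  · simpa [glue, hi] using hAi

/-- The ratio `h₄ / h₃` that the boundary condition prescribes on the diagonal. -/
noncomputable def reflection (c : ℝ) : ℝ := ((1 + c) / (1 - c)) ^ 2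

/-- The datum of the fourth component at the point where the fourth characteristic through `(y, y)`
meets the line `z = X`, chosen such that the boundary condition holds at `(y, y)`. For `y > X` that
point lies below `(X, X)`, where the side data prescribe nothing. -/
noncomputable def inflow (c X : ℝ) (f : ℝ → ℝ) (A : ℝ → Fin 4 → ℝ) (h : ℝ × ℝ → Fin 4 → ℝ)
    (y : ℝ) : ℝ :=
  reflection c * transport c X f A h (y, y) 2 - duhamel c X f h 3 (y, y)

/-- The derivative of `inflow`, where `v` stands for `∂h/∂t` and `x y` for `h (y, y)`. The values
`x` are kept separate from `h` because the fixed-point map needs a normalization of them. -/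
noncomputable def inflowDeriv (c X : ℝ) (f : ℝ → ℝ) (A' : ℝ → Fin 4 → ℝ)
    (v : ℝ × ℝ → Fin 4 → ℝ) (x : ℝ → Fin 4 → ℝ) (y : ℝ) : ℝ :=
  reflection c * ((1 + 1 / c) * transport c X f A' v (y, y) 2 + f y * coupling c 2 (x y)) -
    ((1 - 1 / c) * duhamel c X f v 3 (y, y) + f y * coupling c 3 (x y))

/-- The abscissa at which the fourth characteristic through `(X, θ)` meets the diagonal. Its
derivative is `-c/(1-c)`, the factor that accompanies `inflowDeriv`. -/
noncomputable def foot (c X θ : ℝ) : ℝ := X + c / (1 - c) * (X - θ)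

lemma foot_self (c X : ℝ) : foot c X X = X := by simp [foot]

@[fun_prop]
lemma foot_continuous (c X : ℝ) : Continuous (foot c X) := by
  unfold foot
  fun_prop

lemma inflow_continuous {c X : ℝ} {f : ℝ → ℝ} {A : ℝ → Fin 4 → ℝ} {h : ℝ × ℝ → Fin 4 → ℝ}
    (hf : Continuous f) (hA : Continuous A) (hh : Continuous h) :
    Continuous (inflow c X f A h) := by
  have h1 := transport_continuous (c := c) (X := X) hf hA hh
  have h2 := duhamel_continuous (c := c) (X := X) hf hh 3
  unfold inflow
  fun_prop

lemma inflowDeriv_continuous {c X : ℝ} {f : ℝ → ℝ} {A' : ℝ → Fin 4 → ℝ} {v : ℝ × ℝ → Fin 4 → ℝ}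
    {x : ℝ → Fin 4 → ℝ} (hf : Continuous f) (hA : Continuous A') (hv : Continuous v)
    (hx : Continuous x) : Continuous (inflowDeriv c X f A' v x) := by
  have h1 := transport_continuous (c := c) (X := X) hf hA hv
  have h2 := duhamel_continuous (c := c) (X := X) hf hv 3
  unfold inflowDeriv
  fun_prop

lemma inflow_hasDerivAt {c X : ℝ} {f : ℝ → ℝ} {A A' : ℝ → Fin 4 → ℝ}
    {h v : ℝ × ℝ → Fin 4 → ℝ} (hf : Continuous f) (hh : Continuous h) (hv : Continuous v)
    (hd : ∀ z t, HasDerivAt (fun t => h (z, t)) (v (z, t)) t)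
    (hA : ∀ t, HasDerivAt A (A' t) t) (hA' : Continuous A') (y : ℝ) :
    HasDerivAt (inflow c X f A h) (inflowDeriv c X f A' v (fun y => h (y, y)) y) y := by
  have hdiag : HasDerivAt (fun y : ℝ => (y, y)) ((1 : ℝ), (1 : ℝ)) y :=
    (hasDerivAt_id y).prodMk (hasDerivAt_id y)
  have h1 := HasFDerivAt.comp_hasDerivAt (f := fun y : ℝ => (y, y)) y
    (transport_hasStrictFDerivAt (c := c) (X := X) hf hh hv hd hA hA' (y, y) 2).hasFDerivAt hdiag
  have h2 := HasFDerivAt.comp_hasDerivAt (f := fun y : ℝ => (y, y)) y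
    (duhamel_hasStrictFDerivAt (c := c) (X := X) hf hh hv hd 3 (y, y)).hasFDerivAt hdiag
  refine ((h1.const_mul (reflection c)).sub h2).congr_deriv ?_
  simp [inflowDeriv, slope]
  ring

lemma foot_hasDerivAt (c X θ : ℝ) : HasDerivAt (foot c X) (-(c / (1 - c))) θ := by
  unfold foot
  have := (((hasDerivAt_id θ).const_sub X).const_mul (c / (1 - c))).const_add X
  simpa using this

lemma one_le_ratio {c : ℝ} (hc₀ : 0 < c) (hc₁ : c < 1) : 1 ≤ (1 + c) / (1 - c) := by
  rw [le_div_iff₀ (by linarith)]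
  linarith

lemma one_le_reflection {c : ℝ} (hc₀ : 0 < c) (hc₁ : c < 1) : 1 ≤ reflection c := by
  unfold reflection
  have := one_le_ratio hc₀ hc₁
  nlinarith

lemma inflow_dist_le {c X γ H : ℝ} {f : ℝ → ℝ} {A : ℝ → Fin 4 → ℝ}
    {h h' : ℝ × ℝ → Fin 4 → ℝ} (hc₀ : 0 < c) (hc₁ : c < 1)
    (hf : Continuous f) (hγ : ∀ x y, |(∫ s in x..y, |f s|)| ≤ γ)
    (hh : Continuous h) (hh' : Continuous h') (hH : ∀ p j, |h p j - h' p j| ≤ H) (y : ℝ) :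
    |inflow c X f A h y - inflow c X f A h' y| ≤ (reflection c + 1) * (γ / c * H) := by
  have h1 := transport_dist_le (X := X) (α := A) (α' := A) (D := 0) hc₀ hc₁ hf hγ hh hh' hH
    (by simp) (y, y) 2
  have h2 := duhamel_dist_le (X := X) hc₀ hc₁ hf hγ hh hh' hH 3 (y, y)
  have hK := one_le_reflection hc₀ hc₁
  unfold inflow
  rw [abs_le] at *
  constructor <;> nlinarith

lemma inflow_abs_le {c X γ H D : ℝ} {f : ℝ → ℝ} {A : ℝ → Fin 4 → ℝ}
    {h : ℝ × ℝ → Fin 4 → ℝ} (hc₀ : 0 < c) (hc₁ : c < 1)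
    (hf : Continuous f) (hγ : ∀ x y, |(∫ s in x..y, |f s|)| ≤ γ)
    (hH : ∀ p j, |h p j| ≤ H) (hD : ∀ t j, |A t j| ≤ D) (y : ℝ) :
    |inflow c X f A h y| ≤ reflection c * D + (reflection c + 1) * (γ / c * H) := by
  have h1 := transport_abs_le (X := X) hc₀ hc₁ hf hγ hH hD (y, y) 2
  have h2 := duhamel_abs_le (X := X) hc₀ hc₁ hf hγ hH 3 (y, y)
  have hK := one_le_reflection hc₀ hc₁
  unfold inflow
  rw [abs_le] at *
  constructor <;> nlinarith

/-- The common estimate behind the bounds for `inflowDeriv`. -/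
lemma abs_combination_le {c T D' F₂ F₃ P Q R : ℝ} (hc₀ : 0 < c) (hc₁ : c < 1)
    (hT : |T| ≤ P) (hD : |D'| ≤ Q) (h₂ : |F₂| ≤ R) (h₃ : |F₃| ≤ R) :
    |-(c / (1 - c)) * (reflection c * ((1 + 1 / c) * T + F₂) - ((1 - 1 / c) * D' + F₃))| ≤
      reflection c * ((1 + c) / (1 - c)) * P + Q + c / (1 - c) * (reflection c + 1) * R := by
  have hc : 0 < 1 - c := by linarith
  have hK := one_le_reflection hc₀ hc₁
  have e : -(c / (1 - c)) * (reflection c * ((1 + 1 / c) * T + F₂) - ((1 - 1 / c) * D' + F₃)) =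
      -(reflection c * ((1 + c) / (1 - c)) * T) - D' -
        c / (1 - c) * (reflection c * F₂) + c / (1 - c) * F₃ := by
    field_simp
    ring
  rw [e]
  have hr : 0 < (1 + c) / (1 - c) := by positivity
  have hm : 0 < c / (1 - c) := by positivity
  have b1 : |reflection c * ((1 + c) / (1 - c)) * T| ≤
      reflection c * ((1 + c) / (1 - c)) * P := by
    rw [abs_mul, abs_of_nonneg (by positivity)]
    gcongr
  have b2 : |c / (1 - c) * (reflection c * F₂)| ≤ c / (1 - c) * (reflection c * R) := by
    rw [abs_mul, abs_of_pos hm, abs_mul, abs_of_nonneg (by linarith : 0 ≤ reflection c)]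
    gcongr
  have b3 : |c / (1 - c) * F₃| ≤ c / (1 - c) * R := by
    rw [abs_mul, abs_of_pos hm]
    gcongr
  rw [abs_le] at *
  constructor <;> nlinarith

lemma inflowDeriv_dist_le {c X γ V H B : ℝ} {f : ℝ → ℝ} {A' : ℝ → Fin 4 → ℝ}
    {v v' : ℝ × ℝ → Fin 4 → ℝ} {x x' : ℝ → Fin 4 → ℝ} (hc₀ : 0 < c) (hc₁ : c < 1)
    (hf : Continuous f) (hB : ∀ s, |f s| ≤ B) (hγ : ∀ x y, |(∫ s in x..y, |f s|)| ≤ γ)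
    (hv : Continuous v) (hv' : Continuous v') (hV : ∀ p j, |v p j - v' p j| ≤ V)
    (hx : ∀ y j, |x y j - x' y j| ≤ H) (y : ℝ) :
    |-(c / (1 - c)) * inflowDeriv c X f A' v x y - -(c / (1 - c)) * inflowDeriv c X f A' v' x' y| ≤
      (reflection c * ((1 + c) / (1 - c)) + 1) * (γ / c * V) +
        c / (1 - c) * (reflection c + 1) * (B * (H / c)) := by
  have h1 := transport_dist_le (X := X) (α := A') (α' := A') (D := 0) hc₀ hc₁ hf hγ hv hv' hV
    (by simp) (y, y) 2
  have h2 := duhamel_dist_le (X := X) hc₀ hc₁ hf hγ hv hv' hV 3 (y, y)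
  have h3 : ∀ i, |f y * coupling c i (x y - x' y)| ≤ B * (H / c) := fun i => by
    rw [abs_mul]
    exact mul_le_mul (hB y) (abs_coupling_le hc₀ hc₁ i fun j => hx y j) (abs_nonneg _)
      ((abs_nonneg _).trans (hB y))
  have h4 := abs_combination_le hc₀ hc₁ h1 h2 (h3 2) (h3 3)
  simp only [coupling_sub] at h4
  unfold inflowDeriv
  convert h4 using 2 <;> ring

lemma inflowDeriv_abs_le {c X γ V H B D : ℝ} {f : ℝ → ℝ} {A' : ℝ → Fin 4 → ℝ}
    {v : ℝ × ℝ → Fin 4 → ℝ} {x : ℝ → Fin 4 → ℝ} (hc₀ : 0 < c) (hc₁ : c < 1)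
    (hf : Continuous f) (hB : ∀ s, |f s| ≤ B) (hγ : ∀ x y, |(∫ s in x..y, |f s|)| ≤ γ)
    (hV : ∀ p j, |v p j| ≤ V) (hD : ∀ t j, |A' t j| ≤ D)
    (hx : ∀ y j, |x y j| ≤ H) (y : ℝ) :
    |-(c / (1 - c)) * inflowDeriv c X f A' v x y| ≤
      reflection c * ((1 + c) / (1 - c)) * (D + γ / c * V) + γ / c * V +
        c / (1 - c) * (reflection c + 1) * (B * (H / c)) := by
  have h1 := transport_abs_le (X := X) hc₀ hc₁ hf hγ hV hD (y, y) 2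
  have h2 := duhamel_abs_le (X := X) hc₀ hc₁ hf hγ hV 3 (y, y)
  have h3 : ∀ i, |f y * coupling c i (x y)| ≤ B * (H / c) := fun i => by
    rw [abs_mul]
    exact mul_le_mul (hB y) (abs_coupling_le hc₀ hc₁ i fun j => hx y j) (abs_nonneg _)
      ((abs_nonneg _).trans (hB y))
  exact abs_combination_le hc₀ hc₁ h1 h2 (h3 2) (h3 3)

/-! ### Existence of `C¹` solutions in the plane -/

section

open BoundedContinuousFunction

/-- The pairs `(h, w)` of bounded continuous functions with `w = η ∂h/∂t` and with the prescribed
value of `h` at the corner `(X, X)`. -/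
def derivPairs (η X : ℝ) (x₀ : Fin 4 → ℝ) :
    Set (((ℝ × ℝ) →ᵇ (Fin 4 → ℝ)) × ((ℝ × ℝ) →ᵇ (Fin 4 → ℝ))) :=
  {x | x.1 (X, X) = x₀ ∧
    ∀ z t, η • (x.1 (z, t) - x.1 (z, 0)) = ∫ s in (0 : ℝ)..t, x.2 (z, s)}

lemma isClosed_derivPairs (η X : ℝ) (x₀ : Fin 4 → ℝ) : IsClosed (derivPairs η X x₀) := by
  have hint : ∀ z t : ℝ, Continuous fun w : (ℝ × ℝ) →ᵇ (Fin 4 → ℝ) =>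
      ∫ s in (0 : ℝ)..t, w (z, s) := by
    intro z t
    refine LipschitzWith.continuous (K := Real.nnabs t) (LipschitzWith.of_dist_le_mul ?_)
    intro w w'
    rw [dist_eq_norm, ← intervalIntegral.integral_sub
      ((by fun_prop : Continuous fun s => w (z, s)).intervalIntegrable _ _)
      ((by fun_prop : Continuous fun s => w' (z, s)).intervalIntegrable _ _)]
    have := intervalIntegral.norm_integral_le_of_norm_le_const (a := 0) (b := t)
      (f := fun s => w (z, s) - w' (z, s)) (C := dist w w')
      (fun s _ => by rw [← dist_eq_norm]; exact dist_coe_le_dist _)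
    simpa [mul_comm, Real.coe_nnabs] using this
  have e : derivPairs η X x₀ = {x | x.1 (X, X) = x₀} ∩
      ⋂ z, ⋂ t, {x | η • (x.1 (z, t) - x.1 (z, 0)) = ∫ s in (0 : ℝ)..t, x.2 (z, s)} := by
    ext x
    simp [derivPairs]
  have hev : ∀ p : ℝ × ℝ, Continuous fun x : ((ℝ × ℝ) →ᵇ (Fin 4 → ℝ)) × ((ℝ × ℝ) →ᵇ (Fin 4 → ℝ)) =>
      x.1 p := fun p => (continuous_eval_const (x := p)).comp continuous_fst
  rw [e]
  refine (isClosed_eq (hev _) continuous_const).inter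
    (isClosed_iInter fun z => isClosed_iInter fun t => isClosed_eq ?_ ?_)
  · exact ((hev _).sub (hev _)).const_smul η
  · exact (hint z t).comp continuous_snd

lemma hasDerivAt_of_mem_derivPairs {η X : ℝ} {x₀ : Fin 4 → ℝ} (hη : 0 < η)
    {x : ((ℝ × ℝ) →ᵇ (Fin 4 → ℝ)) × ((ℝ × ℝ) →ᵇ (Fin 4 → ℝ))} (hx : x ∈ derivPairs η X x₀)
    (z t : ℝ) : HasDerivAt (fun t => x.1 (z, t)) (η⁻¹ • x.2 (z, t)) t := by
  have hc : Continuous fun s => x.2 (z, s) := by fun_prop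
  have h := ((intervalIntegral.integral_hasDerivAt_right (hc.intervalIntegrable 0 t)
    (hc.stronglyMeasurableAtFilter _ _) hc.continuousAt).const_smul η⁻¹).add_const (x.1 (z, 0))
  refine h.congr_of_eventuallyEq (Eventually.of_forall fun s => ?_)
  simp only [Pi.smul_apply]
  rw [← hx.2 z s, smul_smul, inv_mul_cancel₀ hη.ne', one_smul, sub_add_cancel]

/-- The initial-boundary value problem extended to the whole plane. The coefficient is so small in
`L¹` that the problem for the pair `(h, ∂h/∂t)` is a contraction in the supremum norm; the two
compatibility conditions `hval`, `hder` at the corner make the solution `C¹`. -/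
theorem exists_planar_solution {c X γ B C : ℝ} {f : ℝ → ℝ} {A A' : ℝ → Fin 4 → ℝ} (hc₀ : 0 < c)
    (hc₁ : c < 1) (hf : Continuous f) (hB : ∀ s, |f s| ≤ B)
    (hγ : ∀ x y, |(∫ s in x..y, |f s|)| ≤ γ)
    (hsmall : (reflection c * ((1 + c) / (1 - c)) + 2) * (γ / c) ≤ 1 / 2)
    (hA : ∀ t, HasDerivAt A (A' t) t) (hA' : Continuous A')
    (hAC : ∀ t j, |A t j| ≤ C) (hAC' : ∀ t j, |A' t j| ≤ C)
    (hval : reflection c * A X 2 = A X 3)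
    (hder : reflection c * ((1 + 1 / c) * A' X 2 + f X * coupling c 2 (A X)) -
      f X * coupling c 3 (A X) = (1 - 1 / c) * A' X 3) :
    ∃ h : ℝ × ℝ → Fin 4 → ℝ, ContDiff ℝ 1 h ∧
      (∀ p, fderiv ℝ h p (0, 1) =
        (matA c).mulVec (fderiv ℝ h p (1, 0)) + f p.1 • (matB c).mulVec (h p)) ∧
      (∀ y, X ≤ y → h (y, y) 3 = reflection c * h (y, y) 2) ∧
      (∀ t, X ≤ t → h (X, t) = A t) := by
  have hK := one_le_reflection hc₀ hc₁
  have hρ := one_le_ratio hc₀ hc₁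
  have hcc : 0 < 1 - c := by linarith
  have hγ0 : 0 ≤ γ := (abs_nonneg _).trans (hγ 0 0)
  have hB0 : 0 ≤ B := (abs_nonneg _).trans (hB 0)
  have hAcont : Continuous A := continuous_iff_continuousAt.2 fun t => (hA t).continuousAt
  -- `P` bounds the effect of `h` on the data of `∂h/∂t`, and `η` is the weight that makes it small
  set P : ℝ := c / (1 - c) * (reflection c + 1) * (B * (2 / c)) with hP
  have hP0 : 0 ≤ P := by positivity
  set η : ℝ := 1 / (4 * (P + 1)) with hη
  have hη0 : 0 < η := by positivity
  have hηP : η * P ≤ 1 / 4 := by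
    rw [hη, div_mul_eq_mul_div, div_le_iff₀ (by positivity)]
    linarith
  let E := (ℝ × ℝ) →ᵇ (Fin 4 → ℝ)
  -- the boundary values of `h`, corrected so that the data below are continuous at the corner for
  -- every `h`; on `derivPairs` the correction vanishes
  let bv : E → ℝ → Fin 4 → ℝ := fun h y => h (y, y) - h (X, X) + A X
  let α : E → ℝ → Fin 4 → ℝ := fun h => glue X A fun θ => inflow c X f A h (foot c X θ)
  let vel : E → ℝ × ℝ → Fin 4 → ℝ := fun w p => η⁻¹ • w p
  let α' : E → E → ℝ → Fin 4 → ℝ := fun h w => glue X A' fun θ =>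
    -(c / (1 - c)) * inflowDeriv c X f A' (vel w) (bv h) (foot c X θ)
  have hcoord : ∀ (h : E) p j, |h p j| ≤ ‖h‖ := fun h p j =>
    (norm_le_pi_norm (h p) j).trans (h.norm_coe_le_norm p)
  have hvelc : ∀ w : E, Continuous (vel w) := fun w => by
    simp only [vel]
    fun_prop
  have hbvc : ∀ h : E, Continuous (bv h) := fun h => by
    simp only [bv]
    fun_prop
  have hinX : ∀ h : E, inflow c X f A h (foot c X X) = A X 3 := by
    intro h
    rw [foot_self, ← hval]
    simp [inflow, transport, duhamel_self]
  have hinX' : ∀ h w : E, -(c / (1 - c)) * inflowDeriv c X f A' (vel w) (bv h) (foot c X X) =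
      A' X 3 := by
    intro h w
    rw [foot_self]
    have : bv h X = A X := by simp [bv]
    simp only [inflowDeriv, transport, duhamel_self, this]
    simp only [sub_self, mul_zero, sub_zero, add_zero, zero_add]
    rw [hder]
    field_simp
    ring
  have hαc : ∀ h : E, Continuous (α h) := fun h =>
    glue_continuous hAcont ((inflow_continuous hf hAcont h.continuous).comp (foot_continuous c X))
      (hinX h)
  have hα'c : ∀ h w : E, Continuous (α' h w) := fun h w =>
    glue_continuous hA' (continuous_const.mul
      ((inflowDeriv_continuous hf hA' (hvelc w) (hbvc h)).comp (foot_continuous c X))) (hinX' h w)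
  -- the two components of the map whose fixed point is sought
  have hT1 : ∀ h : E, ∃ g : E, ∀ p, g p = transport c X f (α h) h p := by
    intro h
    have hb : ∀ p i, |transport c X f (α h) h p i| ≤
        (reflection c * C + (reflection c + 1) * (γ / c * ‖h‖)) + γ / c * ‖h‖ := by
      refine transport_abs_le hc₀ hc₁ hf hγ (hcoord h) (glue_abs_le (fun θ i => ?_) fun θ => ?_)
      · refine (hAC θ i).trans ?_
        have : 0 ≤ (reflection c + 1) * (γ / c * ‖h‖) := by positivity
        nlinarith [(abs_nonneg _).trans (hAC θ i)]
      · exact inflow_abs_le hc₀ hc₁ hf hγ (hcoord h) hAC _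
    exact ⟨ofNormedAddCommGroup _ (transport_continuous hf (hαc h) h.continuous) _ fun p =>
      (pi_norm_le_iff_of_nonneg ((abs_nonneg _).trans (hb p 0))).2 (hb p), fun p => rfl⟩
  have hT2 : ∀ h w : E, ∃ g : E, ∀ p, g p = η • transport c X f (α' h w) (vel w) p := by
    intro h w
    have hvb : ∀ p j, |vel w p j| ≤ η⁻¹ * ‖w‖ := fun p j => by
      simp only [vel, Pi.smul_apply, smul_eq_mul, abs_mul, abs_of_pos (inv_pos.2 hη0)]
      exact mul_le_mul_of_nonneg_left (hcoord w p j) (by positivity)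
    have hbb : ∀ y j, |bv h y j| ≤ ‖h‖ + ‖h‖ + C := fun y j => by
      simp only [bv, Pi.add_apply, Pi.sub_apply]
      exact (abs_add_le _ _).trans (add_le_add ((abs_sub _ _).trans
        (add_le_add (hcoord _ _ _) (hcoord _ _ _))) (hAC _ _))
    obtain ⟨D, hCD, hD⟩ : ∃ D, C ≤ D ∧ ∀ θ,
        |-(c / (1 - c)) * inflowDeriv c X f A' (vel w) (bv h) (foot c X θ)| ≤ D :=
      ⟨_, le_max_left _ _, fun θ => (inflowDeriv_abs_le hc₀ hc₁ hf hB hγ hvb hAC' hbb _).trans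
        (le_max_right _ _)⟩
    have hb := transport_abs_le (X := X) (α := α' h w) (D := D) hc₀ hc₁ hf hγ hvb
      (glue_abs_le (fun θ i => (hAC' θ i).trans hCD) hD)
    refine ⟨ofNormedAddCommGroup (fun p => η • transport c X f (α' h w) (vel w) p)
      ((transport_continuous hf (hα'c h w) (hvelc w)).const_smul η)
      (η * (D + γ / c * (η⁻¹ * ‖w‖))) fun p => ?_, fun p => rfl⟩
    rw [norm_smul, Real.norm_of_nonneg hη0.le]
    exact mul_le_mul_of_nonneg_left
      ((pi_norm_le_iff_of_nonneg ((abs_nonneg _).trans (hb p 0))).2 (hb p)) hη0.le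
  choose T₁ hT₁ using hT1
  choose T₂ hT₂ using hT2
  let Φ : E × E → E × E := fun x => (T₁ x.1, T₂ x.1 x.2)
  have hderiv : ∀ x ∈ derivPairs η X (A X), (∀ z t, HasDerivAt (fun t => x.1 (z, t))
      (vel x.2 (z, t)) t) ∧ ∀ t, HasDerivAt (α x.1) (α' x.1 x.2 t) t := by
    intro x hx
    have h1 : ∀ z t, HasDerivAt (fun t => x.1 (z, t)) (vel x.2 (z, t)) t := fun z t =>
      hasDerivAt_of_mem_derivPairs hη0 hx z t
    refine ⟨h1, glue_hasDerivAt hA (fun θ => ?_) (hinX _) (hinX' _ _)⟩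
    have h2 := (inflow_hasDerivAt (c := c) (X := X) hf x.1.continuous (hvelc x.2) h1 hA hA'
      (foot c X θ)).comp θ (foot_hasDerivAt c X θ)
    have h3 : bv x.1 = fun y => x.1 (y, y) := by
      funext y
      simp [bv, hx.1]
    rw [h3, mul_comm]
    exact h2
  have hmaps : MapsTo Φ (derivPairs η X (A X)) (derivPairs η X (A X)) := by
    intro x hx
    obtain ⟨h1, h2⟩ := hderiv x hx
    refine ⟨?_, fun z t => ?_⟩
    · ext i
      simp only [Φ, hT₁, transport, duhamel_self, α, sub_self, mul_zero, sub_zero, add_zero]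
      rw [glue_of_le _ _ le_rfl]
    · have h3 : ∀ s, HasDerivAt (fun t => η • T₁ x.1 (z, t)) (T₂ x.1 x.2 (z, s)) s := by
        intro s
        rw [hT₂]
        refine HasDerivAt.const_smul η (hasDerivAt_pi.2 fun i => ?_)
        simp only [hT₁]
        have := HasFDerivAt.comp_hasDerivAt (f := fun t : ℝ => (z, t)) s
          (transport_hasStrictFDerivAt (c := c) (X := X) hf x.1.continuous (hvelc x.2) h1 h2
            (hα'c _ _) (z, s) i).hasFDerivAt ((hasDerivAt_const s z).prodMk (hasDerivAt_id s))
        exact this.congr_deriv (by simp)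
      have h4 := intervalIntegral.integral_eq_sub_of_hasDerivAt (a := 0) (b := t)
        (fun s _ => h3 s)
        ((by fun_prop : Continuous fun s => T₂ x.1 x.2 (z, s)).intervalIntegrable _ _)
      simp only [Φ]
      rw [h4, smul_sub]
  have hγc : 0 ≤ γ / c := by positivity
  have hcontr : ContractingWith (3 / 4) Φ := by
    refine ⟨by rw [← NNReal.coe_lt_coe]; norm_num, LipschitzWith.of_dist_le_mul fun x y => ?_⟩
    have hd1 : ∀ p j, |x.1 p j - y.1 p j| ≤ dist x y := fun p j => by
      rw [← Real.dist_eq]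
      exact (dist_le_pi_dist _ _ j).trans ((dist_coe_le_dist p).trans (le_max_left _ _))
    have hd2 : ∀ p j, |x.2 p j - y.2 p j| ≤ dist x y := fun p j => by
      rw [← Real.dist_eq]
      exact (dist_le_pi_dist _ _ j).trans ((dist_coe_le_dist p).trans (le_max_right _ _))
    have hd0 : 0 ≤ dist x y := dist_nonneg
    have h34 : (((3 / 4 : NNReal)) : ℝ) = 3 / 4 := by norm_num
    rw [h34]
    refine max_le ?_ ?_
    · refine (BoundedContinuousFunction.dist_le (by positivity)).2 fun p => ?_
      refine (dist_pi_le_iff (by positivity)).2 fun j => ?_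
      simp only [Φ, hT₁, Real.dist_eq]
      refine (transport_dist_le hc₀ hc₁ hf hγ x.1.continuous y.1.continuous hd1
        (glue_dist_le fun θ => inflow_dist_le hc₀ hc₁ hf hγ x.1.continuous y.1.continuous hd1 _)
        p j).trans ?_
      have : (reflection c + 2) * (γ / c) ≤ 1 / 2 := by
        refine le_trans (mul_le_mul_of_nonneg_right ?_ hγc) hsmall
        nlinarith
      nlinarith
    · refine (BoundedContinuousFunction.dist_le (by positivity)).2 fun p => ?_
      refine (dist_pi_le_iff (by positivity)).2 fun j => ?_
      simp only [Φ, hT₂, Real.dist_eq, Pi.smul_apply, smul_eq_mul]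
      have hv : ∀ p j, |vel x.2 p j - vel y.2 p j| ≤ η⁻¹ * dist x y := fun p j => by
        simp only [vel, Pi.smul_apply, smul_eq_mul, ← mul_sub, abs_mul,
          abs_of_pos (inv_pos.2 hη0)]
        exact mul_le_mul_of_nonneg_left (hd2 p j) (by positivity)
      have hb : ∀ s j, |bv x.1 s j - bv y.1 s j| ≤ 2 * dist x y := fun s j => by
        have e1 := hd1 (s, s) j
        have e2 := hd1 (X, X) j
        simp only [bv, Pi.add_apply, Pi.sub_apply]
        rw [abs_le] at *
        constructor <;> linarith
      have hmain := transport_dist_le (X := X) hc₀ hc₁ hf hγ (hvelc x.2) (hvelc y.2) hv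
        (glue_dist_le (A := A') (X := X) fun θ =>
          inflowDeriv_dist_le (X := X) (A' := A') hc₀ hc₁ hf hB hγ (hvelc x.2)
            (hvelc y.2) hv hb (foot c X θ)) p j
      rw [← mul_sub, abs_mul, abs_of_pos hη0]
      refine (mul_le_mul_of_nonneg_left hmain hη0.le).trans ?_
      have e : η * ((reflection c * ((1 + c) / (1 - c)) + 1) * (γ / c * (η⁻¹ * dist x y)) +
          c / (1 - c) * (reflection c + 1) * (B * (2 * dist x y / c)) +
            γ / c * (η⁻¹ * dist x y)) =
          (reflection c * ((1 + c) / (1 - c)) + 2) * (γ / c) * dist x y +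
            (η * P) * dist x y := by
        rw [hP]
        field_simp
        ring
      rw [e]
      nlinarith
  -- the iteration starts from a pair that does not depend on `z` and `t`
  let x₁ : E × E := (BoundedContinuousFunction.const _ (A X), 0)
  have hx₁ : x₁ ∈ derivPairs η X (A X) := ⟨rfl, fun z t => by simp [x₁]⟩
  obtain ⟨x, hx, hfix, -⟩ := (hcontr.restrict hmaps).exists_fixedPoint'
    (isClosed_derivPairs η X (A X)).isComplete hmaps hx₁ (edist_ne_top _ _)
  obtain ⟨h1, h2⟩ := hderiv x hx
  have hfix1 : ∀ p, transport c X f (α x.1) x.1 p = x.1 p := fun p => by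
    rw [← hT₁]
    exact congrArg (fun y : E × E => y.1 p) hfix
  have hfix2 : ∀ p, transport c X f (α' x.1 x.2) (vel x.2) p = vel x.2 p := fun p => by
    have : η • transport c X f (α' x.1 x.2) (vel x.2) p = x.2 p := by
      rw [← hT₂]
      exact congrArg (fun y : E × E => y.2 p) hfix
    simp only [vel]
    rw [← this, smul_smul, inv_mul_cancel₀ hη0.ne', one_smul]
  have hD : ∀ p i, HasStrictFDerivAt (fun p => x.1 p i)
      ((f p.1 * coupling c i (x.1 p) - slope c i * vel x.2 p i) • ContinuousLinearMap.fst ℝ ℝ ℝ +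
        vel x.2 p i • ContinuousLinearMap.snd ℝ ℝ ℝ) p := by
    intro p i
    have := transport_hasStrictFDerivAt (c := c) (X := X) hf x.1.continuous (hvelc x.2) h1 h2
      (hα'c _ _) p i
    simp only [hfix1, hfix2] at this
    exact this
  have hD' : ∀ p, HasFDerivAt x.1 (ContinuousLinearMap.pi fun i =>
      ((f p.1 * coupling c i (x.1 p) - slope c i * vel x.2 p i) • ContinuousLinearMap.fst ℝ ℝ ℝ +
        vel x.2 p i • ContinuousLinearMap.snd ℝ ℝ ℝ)) p := fun p =>
    hasFDerivAt_pi.2 fun i => (hD p i).hasFDerivAt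
  refine ⟨x.1, ?_, fun p => ?_, fun y hy => ?_, fun t ht => ?_⟩
  · refine contDiff_pi.2 fun i => contDiff_one_iff_hasFDerivAt.2 ⟨_, ?_, fun p =>
      (hD p i).hasFDerivAt⟩
    have := hvelc x.2
    fun_prop
  · rw [(hD' p).fderiv, matA_mulVec]
    ext i
    fin_cases i <;> simp [slope, coupling] <;> field_simp <;> ring
  · have e2 := congrFun (hfix1 (y, y)) 2
    have e3 := congrFun (hfix1 (y, y)) 3
    have hθ : y - slope c 3 * (y - X) ≤ X := by
      have : 1 ≤ 1 / c := by rw [le_div_iff₀ hc₀]; linarith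
      simp only [slope, Matrix.cons_val]
      nlinarith
    have hfoot : foot c X (y - slope c 3 * (y - X)) = y := by
      simp only [foot, slope, Matrix.cons_val]
      field_simp
      ring
    have e4 : α x.1 (y - slope c 3 * (y - X)) 3 = inflow c X f A x.1 y := by
      simp only [α]
      rw [glue_last_of_le A (hinX _) hθ, hfoot]
    have e5 : transport c X f A x.1 (y, y) 2 = x.1 (y, y) 2 := by
      rw [← e2]
      simp [transport, α, glue]
    rw [← e3, transport, e4, inflow, e5]
    ring
  · rw [← hfix1]
    ext i
    simp only [transport, duhamel_self, sub_self, mul_zero, sub_zero, add_zero, α]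
    rw [glue_of_le _ _ ht]

end

/-! ### Existence for the sideways problem on a slab -/

lemma convex_slab (c Z X X' : ℝ) : Convex ℝ (slab c Z X X') := by
  rintro ⟨z, t⟩ ⟨h1, h2, h3, h4⟩ ⟨z', t'⟩ ⟨h1', h2', h3', h4'⟩ a b ha hb hab
  simp only [slab, mem_ofPred_eq, Prod.smul_mk, Prod.mk_add_mk, smul_eq_mul] at *
  obtain rfl : b = 1 - a := by linarith
  refine ⟨by nlinarith, by nlinarith, by nlinarith, ?_⟩
  rw [show (a * z + (1 - a) * z') / c = a * (z / c) + (1 - a) * (z' / c) by ring]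
  nlinarith

/-- Up to the depth `Y` the diagonal lies below the upper edge of the slabs. -/
lemma le_top {c Z z : ℝ} (hc₀ : 0 < c) (hz : z ≤ depth c Z) : z ≤ 2 * Z - z / c := by
  unfold depth at hz
  rw [le_div_iff₀ (by linarith)] at hz
  have : z + z / c ≤ 2 * Z := by
    rw [← sub_nonneg]
    have : 2 * Z - (z + z / c) = (2 * c * Z - z * (1 + c)) / c := by
      field_simp
      ring
    rw [this]
    exact div_nonneg (by linarith) hc₀.le
  linarith

lemma lt_top_of_lt_depth {c Z z : ℝ} (hc₀ : 0 < c) (hz : z < depth c Z) : z < 2 * Z - z / c := by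
  unfold depth at hz
  rw [lt_div_iff₀ (by linarith)] at hz
  have : z + z / c < 2 * Z := by
    rw [← sub_pos]
    have : 2 * Z - (z + z / c) = (2 * c * Z - z * (1 + c)) / c := by
      field_simp
      ring
    rw [this]
    exact div_pos (by linarith) hc₀
  linarith

lemma diag_mem_slab {c Z X X' z : ℝ} (hc₀ : 0 < c) (hX' : X' ≤ depth c Z) (hz : z ∈ Icc X X') :
    (z, z) ∈ slab c Z X X' :=
  ⟨hz.1, hz.2, le_rfl, le_top hc₀ (hz.2.trans hX')⟩

lemma side_mem_slab {c Z X X' z t : ℝ} (hz : z ∈ Icc X X') (ht : t ∈ Icc z (2 * Z - z / c)) :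
    (z, t) ∈ slab c Z X X' :=
  ⟨hz.1, hz.2, ht.1, ht.2⟩

lemma uniqueDiffOn_slab {c Z X X' : ℝ} (hc₀ : 0 < c) (hX : X < X') (hX' : X' ≤ depth c Z) :
    UniqueDiffOn ℝ (slab c Z X X') := by
  refine uniqueDiffOn_convex (convex_slab c Z X X') ?_
  let U : Set (ℝ × ℝ) := {p | X < p.1 ∧ p.1 < X' ∧ p.1 < p.2 ∧ p.2 < 2 * Z - p.1 / c}
  have hU : IsOpen U := by
    refine (isOpen_lt continuous_const continuous_fst).inter
      ((isOpen_lt continuous_fst continuous_const).inter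
        ((isOpen_lt continuous_fst continuous_snd).inter
          (isOpen_lt continuous_snd ?_)))
    fun_prop
  have hsub : U ⊆ slab c Z X X' := fun p hp => ⟨hp.1.le, hp.2.1.le, hp.2.2.1.le, hp.2.2.2.le⟩
  have hlt := lt_top_of_lt_depth (z := (X + X') / 2) hc₀ (Z := Z) (by linarith)
  obtain ⟨t, ht1, ht2⟩ := exists_between hlt
  exact ⟨((X + X') / 2, t), interior_maximal hsub hU
    ⟨by simp only; linarith, by simp only; linarith, ht1, ht2⟩⟩

/-- A continuous function on `[p, q]` extends to a bounded continuous function on the line with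
almost the same `L¹` norm. -/
lemma exists_extension {F : Type*} [NormedAddCommGroup F] [NormedSpace ℝ F] {p q ω : ℝ}
    {g : ℝ → F} (hpq : p ≤ q) (hω : 0 < ω) (hg : ContinuousOn g (Icc p q)) :
    ∃ G : ℝ → F, Continuous G ∧ EqOn G g (Icc p q) ∧ (∃ C, ∀ s, ‖G s‖ ≤ C) ∧
      ∀ x y, |(∫ s in x..y, ‖G s‖)| ≤ (∫ s in p..q, ‖g s‖) + ω := by
  obtain ⟨C, hC⟩ := isCompact_Icc.exists_bound_of_continuousOn hg
  have hC0 : 0 ≤ C := (norm_nonneg _).trans (hC p ⟨le_rfl, hpq⟩)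
  set η : ℝ := ω / (2 * (C + 1)) with hη
  have hη0 : 0 < η := by positivity
  have hηC : 2 * (C * η) ≤ ω := by
    rw [hη, mul_div_assoc', mul_div_assoc', div_le_iff₀ (by positivity)]
    nlinarith
  -- continue by the boundary values, and cut off within the distance `η`
  let π : ℝ → ℝ := fun s => projIcc p q hpq s
  have hπ : Continuous π := continuous_subtype_val.comp continuous_projIcc
  have hπmem : ∀ s, π s ∈ Icc p q := fun s => (projIcc p q hpq s).2
  have hπid : ∀ s ∈ Icc p q, π s = s := fun s hs => by simp [π, projIcc_of_mem hpq hs]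
  let χ : ℝ → ℝ := fun s => max 0 (1 - |s - π s| / η)
  have hχ : Continuous χ := by fun_prop
  have hχ0 : ∀ s, 0 ≤ χ s := fun s => le_max_left _ _
  have hχ1 : ∀ s, χ s ≤ 1 := fun s => max_le zero_le_one (by
    have : 0 ≤ |s - π s| / η := by positivity
    linarith)
  let G : ℝ → F := fun s => χ s • g (π s)
  have hgπ : Continuous fun s => g (π s) := hg.comp_continuous hπ hπmem
  have hG : Continuous G := hχ.smul hgπ
  have hGC : ∀ s, ‖G s‖ ≤ C := fun s => by
    simp only [G, norm_smul, Real.norm_of_nonneg (hχ0 s)]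
    calc χ s * ‖g (π s)‖ ≤ 1 * C := mul_le_mul (hχ1 s) (hC _ (hπmem s)) (norm_nonneg _) zero_le_one
      _ = C := one_mul C
  have hGeq : EqOn G g (Icc p q) := fun s hs => by simp [G, χ, hπid s hs]
  have hsupp : Function.support (fun s => ‖G s‖) ⊆ Ioc (p - η) (q + η) := by
    intro s hs
    by_contra hns
    apply hs
    have : χ s = 0 := by
      refine max_eq_left ?_
      rw [sub_nonpos, one_le_div hη0]
      rw [mem_Ioc, not_and_or, not_lt, not_le] at hns
      rcases hns with h | h
      · have := (hπmem s).1
        rw [abs_sub_comm]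
        exact le_trans (by linarith) (le_abs_self _)
      · have := (hπmem s).2
        exact le_trans (by linarith) (le_abs_self _)
    simp [G, this]
  refine ⟨G, hG, hGeq, ⟨C, hGC⟩, fun x y => ?_⟩
  have hGn : Continuous fun s => ‖G s‖ := hG.norm
  have hint : MeasureTheory.Integrable fun s => ‖G s‖ :=
    hGn.integrable_of_hasCompactSupport
      (HasCompactSupport.of_support_subset_isCompact isCompact_Icc (hsupp.trans Ioc_subset_Icc_self))
  have h1 : |(∫ s in x..y, ‖G s‖)| ≤ ∫ s, ‖G s‖ := by
    have := intervalIntegral.norm_integral_le_integral_norm_uIoc (f := fun s => ‖G s‖) (a := x)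
      (b := y) (μ := MeasureTheory.volume)
    simp only [Real.norm_eq_abs] at this
    refine this.trans ?_
    simp only [abs_norm]
    exact MeasureTheory.setIntegral_le_integral hint (Eventually.of_forall fun s => norm_nonneg _)
  refine h1.trans ?_
  rw [← intervalIntegral.integral_eq_integral_of_support_subset hsupp,
    ← intervalIntegral.integral_add_adjacent_intervals (hGn.intervalIntegrable _ p)
      (hGn.intervalIntegrable _ _),
    ← intervalIntegral.integral_add_adjacent_intervals (hGn.intervalIntegrable p q)
      (hGn.intervalIntegrable _ _)]
  have hpiece : ∀ u : ℝ, (∫ s in u..u + η, ‖G s‖) ≤ C * η := fun u => by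
    have := intervalIntegral.norm_integral_le_of_norm_le_const (a := u) (b := u + η)
      (f := fun s => ‖G s‖) (C := C) (fun s _ => by simpa using hGC s)
    refine (le_abs_self _).trans (this.trans_eq ?_)
    rw [add_sub_cancel_left, abs_of_pos hη0]
  have h2 : ∫ s in p..q, ‖G s‖ = ∫ s in p..q, ‖g s‖ := by
    refine intervalIntegral.integral_congr fun s hs => ?_
    rw [uIcc_of_le hpq] at hs
    simp only [hGeq hs]
  have h3 := hpiece (p - η)
  have h4 := hpiece q
  rw [sub_add_cancel] at h3
  linarith

/-- A `C¹` function on `[p, q]` extends to a bounded `C¹` function on the line with bounded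
derivative. -/
lemma exists_C1_extension {p q : ℝ} {g g' : ℝ → Fin 4 → ℝ} (hpq : p ≤ q)
    (hg : ∀ t ∈ Icc p q, HasDerivWithinAt g (g' t) (Icc p q) t) (hg' : ContinuousOn g' (Icc p q)) :
    ∃ A A' : ℝ → Fin 4 → ℝ, (∀ t, HasDerivAt A (A' t) t) ∧ Continuous A' ∧
      (∃ C, (∀ t j, |A t j| ≤ C) ∧ ∀ t j, |A' t j| ≤ C) ∧
      EqOn A g (Icc p q) ∧ EqOn A' g' (Icc p q) := by
  obtain ⟨A', hA', hAeq, ⟨C, hC⟩, hint⟩ := exists_extension hpq one_pos hg'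
  have hD : ∀ t, HasDerivAt (fun t => g p + ∫ s in p..t, A' s) (A' t) t := fun t =>
    (intervalIntegral.integral_hasDerivAt_right (hA'.intervalIntegrable _ _)
      (hA'.stronglyMeasurableAtFilter _ _) hA'.continuousAt).const_add _
  refine ⟨fun t => g p + ∫ s in p..t, A' s, A', hD, hA',
    ⟨max C (‖g p‖ + ((∫ s in p..q, ‖g' s‖) + 1)), fun t j => le_max_of_le_right ?_,
      fun t j => le_max_of_le_left ((norm_le_pi_norm (A' t) j).trans (hC t))⟩, ?_, hAeq⟩
  · refine (norm_le_pi_norm (g p + ∫ s in p..t, A' s) j).trans ((norm_add_le _ _).trans ?_)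
    exact add_le_add le_rfl
      ((intervalIntegral.norm_integral_le_abs_integral_norm).trans (hint p t))
  · intro t ht
    have hftc := intervalIntegral.integral_eq_sub_of_hasDeriv_right_of_le ht.1
      (f := g) (f' := A')
      (fun s hs => ((hg s ⟨hs.1, hs.2.trans ht.2⟩).continuousWithinAt).mono
        (Icc_subset_Icc_right ht.2))
      (fun s hs => by
        have hs' : s ∈ Icc p q := ⟨hs.1.le, hs.2.le.trans ht.2⟩
        rw [hAeq hs']
        exact ((hg s hs').mono_of_mem_nhdsWithin
          (mem_nhdsWithin_of_mem_nhds (Icc_mem_nhds hs.1 (hs.2.trans_le ht.2)))))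
      (hA'.intervalIntegrable _ _)
    simp only [hftc]
    abel

lemma hasFDerivWithinAt_slab {c Z X X' : ℝ} {h : ℝ × ℝ → Fin 4 → ℝ}
    (hh : ContDiffOn ℝ 1 h (slab c Z X X')) {p : ℝ × ℝ} (hp : p ∈ slab c Z X X') :
    HasFDerivWithinAt h (fderivWithin ℝ h (slab c Z X X') p) (slab c Z X X') p :=
  ((hh.differentiableOn one_ne_zero) p hp).hasFDerivWithinAt

lemma reflection_mul_ratio {c : ℝ} (hc₀ : 0 < c) (hc₁ : c < 1) :
    reflection c * ((c - 1) ^ 2 / (c + 1) ^ 2) = 1 := by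
  have : 1 - c ≠ 0 := by linarith
  have : c - 1 ≠ 0 := by linarith
  unfold reflection
  field_simp
  ring

/-- The compatibility of the derivatives at the corner: differentiate the boundary condition along
the diagonal and eliminate the `z`-derivatives with the system. -/
lemma corner_compatibility {c Z X X' : ℝ} {a : ℝ → Fin 4 → ℝ} {β : ℝ → ℝ}
    {m : ℝ × ℝ → Fin 4 → ℝ} (hc₀ : 0 < c) (hc₁ : c < 1) (hX : X < X') (hX' : X' ≤ depth c Z)
    (hm : IsSidewaysSolution c Z X X' a β m) {v : Fin 4 → ℝ}
    (hv : v = fderivWithin ℝ m (slab c Z X X') (X, X) (0, 1)) :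
    reflection c * ((1 + 1 / c) * v 2 + β X * coupling c 2 (m (X, X))) -
      β X * coupling c 3 (m (X, X)) = (1 - 1 / c) * v 3 := by
  have hXm : X ∈ Icc X X' := left_mem_Icc.2 hX.le
  set D := fderivWithin ℝ m (slab c Z X X') (X, X) with hD
  have hmaps : MapsTo (fun z : ℝ => (z, z)) (Icc X X') (slab c Z X X') := fun z hz =>
    diag_mem_slab hc₀ hX' hz
  have hdiag : HasDerivWithinAt (fun z : ℝ => (z, z)) ((1 : ℝ), (1 : ℝ)) (Icc X X') X :=
    ((hasDerivAt_id X).prodMk (hasDerivAt_id X)).hasDerivWithinAt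
  have h1 : HasDerivWithinAt (fun z : ℝ => m (z, z)) (D (1, 1)) (Icc X X') X :=
    HasFDerivWithinAt.comp_hasDerivWithinAt (f := fun z : ℝ => (z, z)) X
      (hasFDerivWithinAt_slab hm.contDiffOn (hmaps hXm)) hdiag hmaps
  have h2 := (hasDerivWithinAt_pi.1 h1)
  have h3 : HasDerivWithinAt (fun z : ℝ => m (z, z) 2)
      ((c - 1) ^ 2 / (c + 1) ^ 2 * D (1, 1) 3) (Icc X X') X :=
    ((h2 3).const_mul _).congr (fun z hz => hm.diag z hz) (hm.diag X hXm)
  have h4 : D (1, 1) 2 = (c - 1) ^ 2 / (c + 1) ^ 2 * D (1, 1) 3 :=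
    ((uniqueDiffOn_Icc hX) X hXm).eq_deriv _ (h2 2) h3
  have h5 : D (1, 1) = D (1, 0) + D (0, 1) := by
    rw [← map_add]
    simp
  have hpde := hm.pde (X, X) (hmaps hXm)
  rw [← hD, ← hv, matA_mulVec] at hpde
  have e2 := congrFun hpde 2
  have e3 := congrFun hpde 3
  simp only [Pi.add_apply, Pi.smul_apply, smul_eq_mul, Matrix.cons_val] at e2 e3
  rw [h5, ← hv] at h4
  simp only [Pi.add_apply] at h4
  simp only [coupling, slope, Matrix.cons_val]
  have hd2 : D (1, 0) 2 = (v 2 - β X * (matB c).mulVec (m (X, X)) 2) / c := by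
    field_simp
    linarith
  have hd3 : D (1, 0) 3 = -(v 3 - β X * (matB c).mulVec (m (X, X)) 3) / c := by
    field_simp
    linarith
  rw [hd2, hd3] at h4
  have hr := reflection_mul_ratio hc₀ hc₁
  have h6 := congrArg (fun x => reflection c * x) h4
  simp only [← mul_assoc, hr, one_mul] at h6
  have h7 : reflection c * ((1 + 1 / c) * v 2 + β X * (-1 / c * (matB c).mulVec (m (X, X)) 2)) =
      reflection c * ((v 2 - β X * (matB c).mulVec (m (X, X)) 2) / c + v 2) := by
    ring
  rw [h7, h6]
  ring

/-- The sideways problem with the data of a solution `m` for a coefficient `β` is solvable for all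
coefficients `f` that agree with `β` at `X` and are small in `L¹`. -/
theorem exists_sideways {c Z X X' γ : ℝ} {a : ℝ → Fin 4 → ℝ} {β f : ℝ → ℝ}
    {m : ℝ × ℝ → Fin 4 → ℝ} (hc₀ : 0 < c) (hc₁ : c < 1) (hX : X < X')
    (hX' : X' ≤ depth c Z) (hm : IsSidewaysSolution c Z X X' a β m)
    (hf : ContinuousOn f (Icc X X')) (hfX : f X = β X) (hγ0 : 0 < γ)
    (hγ : ∫ s in X..X', |f s| ≤ γ)
    (hsmall : (reflection c * ((1 + c) / (1 - c)) + 2) * ((γ + γ) / c) ≤ 1 / 2) :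
    ∃ h, IsSidewaysSolution c Z X X' a f h := by
  have hXm : X ∈ Icc X X' := left_mem_Icc.2 hX.le
  have hTop : X < 2 * Z - X / c := lt_top_of_lt_depth hc₀ (hX.trans_le hX')
  have hXT : X ∈ Icc X (2 * Z - X / c) := left_mem_Icc.2 hTop.le
  have huniq := uniqueDiffOn_slab hc₀ hX hX'
  obtain ⟨F, hFc, hFeq, ⟨B, hB⟩, hFint⟩ := exists_extension hX.le hγ0 hf
  have hmaps : MapsTo (fun t : ℝ => (X, t)) (Icc X (2 * Z - X / c)) (slab c Z X X') :=
    fun t ht => side_mem_slab hXm ht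
  set m' : ℝ → Fin 4 → ℝ := fun t => fderivWithin ℝ m (slab c Z X X') (X, t) (0, 1) with hm'
  have hder : ∀ t ∈ Icc X (2 * Z - X / c),
      HasDerivWithinAt (fun t => m (X, t)) (m' t) (Icc X (2 * Z - X / c)) t := fun t ht =>
    HasFDerivWithinAt.comp_hasDerivWithinAt (f := fun t : ℝ => (X, t)) t
      (hasFDerivWithinAt_slab hm.contDiffOn (hmaps ht))
      ((hasDerivAt_const t X).prodMk (hasDerivAt_id t)).hasDerivWithinAt hmaps
  have hm'c : ContinuousOn m' (Icc X (2 * Z - X / c)) := by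
    have h1 := (hm.contDiffOn.continuousOn_fderivWithin huniq le_rfl).comp
      (by fun_prop : ContinuousOn (fun t : ℝ => (X, t)) (Icc X (2 * Z - X / c))) hmaps
    exact h1.clm_apply continuousOn_const
  obtain ⟨A, A', hA, hA', ⟨C, hAC, hAC'⟩, hAeq, hAeq'⟩ := exists_C1_extension hTop.le hder hm'c
  have hAX : A X = m (X, X) := hAeq hXT
  have hr := reflection_mul_ratio hc₀ hc₁
  obtain ⟨h, hC1, hpde, hdiag, hside⟩ := exists_planar_solution (X := X) (γ := γ + γ) (B := B)
    (C := C) (f := F) (A := A) (A' := A') hc₀ hc₁ hFc (fun s => by simpa using hB s)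
    (fun x y => by
      refine (hFint x y).trans ?_
      simpa using hγ) hsmall hA hA' hAC hAC'
    (by rw [hAX, hm.diag X hXm, ← mul_assoc, hr, one_mul])
    (by
      rw [hAX, hFeq hXm, hfX, hAeq' hXT]
      exact corner_compatibility hc₀ hc₁ hX hX' hm rfl)
  refine ⟨h, hC1.contDiffOn, fun p hp => ?_, fun z hz => ?_, fun t ht => ?_⟩
  · rw [(hC1.differentiable one_ne_zero p).fderivWithin (huniq p hp), hpde p,
      hFeq ⟨hp.1, hp.2.1⟩]
  · rw [hdiag z hz.1, ← mul_assoc, mul_comm _ (reflection c), hr, one_mul]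
  · exact (hside t ht.1).trans ((hAeq ht).trans (hm.side t ht))

/-! ### Energy density, flux and their balance -/

lemma weight_pos {c : ℝ} (hc₀ : 0 < c) (hc₁ : c < 1) : 0 < weight c := by
  have : 0 < 1 - c := by linarith
  unfold weight
  positivity

/-- The energy density. The weight of the fourth component is chosen so small that the boundary
condition makes the flux through the diagonal nonnegative. -/
noncomputable def density (c : ℝ) (x : Fin 4 → ℝ) : ℝ :=
  x 0 ^ 2 + x 1 ^ 2 + c * x 2 ^ 2 + c * weight c * x 3 ^ 2

/-- The energy flux in the direction of `t` that belongs to `density`. -/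
noncomputable def flux (c : ℝ) (x : Fin 4 → ℝ) : ℝ :=
  x 0 ^ 2 - x 1 ^ 2 + x 2 ^ 2 - weight c * x 3 ^ 2

/-- The rate at which a source `r` in the system feeds the energy of `x`. -/
noncomputable def supply (c : ℝ) (r x : Fin 4 → ℝ) : ℝ :=
  -2 * (r 0 * x 0 - r 1 * x 1 + r 2 * x 2 - weight c * (r 3 * x 3))

@[fun_prop]
lemma density_continuous (c : ℝ) : Continuous (density c) := by
  unfold density
  fun_prop

lemma density_nonneg {c : ℝ} (hc₀ : 0 < c) (hc₁ : c < 1) (x : Fin 4 → ℝ) : 0 ≤ density c x := by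
  have := weight_pos hc₀ hc₁
  unfold density
  positivity

/-- The length of the slab in the direction of `t` at the abscissa `z`. -/
noncomputable def height (c Z z : ℝ) : ℝ := 2 * Z - z / c - z

/-- The coordinates `(z, s)`, with `s ∈ [0, 1]`, that straighten the slabs to rectangles. -/
noncomputable def straighten (c Z : ℝ) (x : ℝ × ℝ) : ℝ × ℝ := (x.1, x.1 + x.2 * height c Z x.1)

/-- The energy of `h` on the vertical segment of the slab at `z`, written as an integral over
`[0, 1]`. -/
noncomputable def lineEnergy (c Z : ℝ) (h : ℝ × ℝ → Fin 4 → ℝ) (z : ℝ) : ℝ :=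
  height c Z z * ∫ s in (0 : ℝ)..1, density c (h (straighten c Z (z, s)))

lemma height_nonneg {c Z z : ℝ} (hc₀ : 0 < c) (hz : z ≤ depth c Z) : 0 ≤ height c Z z := by
  have := le_top hc₀ hz
  unfold height
  linarith

@[fun_prop]
lemma height_continuous (c Z : ℝ) : Continuous (height c Z) := by
  unfold height
  fun_prop

@[fun_prop]
lemma straighten_continuous (c Z : ℝ) : Continuous (straighten c Z) := by
  unfold straighten
  fun_prop

lemma straighten_mem {c Z X X' : ℝ} (hc₀ : 0 < c) (hX' : X' ≤ depth c Z) :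
    MapsTo (straighten c Z) (Icc X X' ×ˢ Icc 0 1) (slab c Z X X') := by
  rintro ⟨z, s⟩ ⟨⟨h1, h2⟩, h3, h4⟩
  simp only at h1 h2 h3 h4
  have h0 := height_nonneg hc₀ (h2.trans hX')
  refine ⟨h1, h2, ?_, ?_⟩
  · simp only [straighten]
    nlinarith
  · simp only [straighten]
    have : s * height c Z z ≤ height c Z z := by nlinarith
    have h5 : height c Z z = 2 * Z - z / c - z := rfl
    linarith

lemma continuousOn_integral_of_continuousOn {X X' : ℝ} {F : ℝ × ℝ → ℝ}
    (hF : ContinuousOn F (Icc X X' ×ˢ Icc 0 1)) :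
    ContinuousOn (fun z => ∫ s in (0 : ℝ)..1, F (z, s)) (Icc X X') := by
  rcases lt_or_ge X' X with hX | hX
  · simp [Icc_eq_empty_of_lt hX]
  let π : ℝ × ℝ → ℝ × ℝ := fun q => (projIcc X X' hX q.1, projIcc 0 1 zero_le_one q.2)
  have hπ : Continuous π :=
    (continuous_subtype_val.comp (continuous_projIcc.comp continuous_fst)).prodMk
      (continuous_subtype_val.comp (continuous_projIcc.comp continuous_snd))
  have hc : Continuous (F ∘ π) := hF.comp_continuous hπ fun q =>
    ⟨(projIcc X X' hX q.1).2, (projIcc (0 : ℝ) 1 zero_le_one q.2).2⟩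
  have hint : Continuous fun z => ∫ s in (0 : ℝ)..1, (F ∘ π) (z, s) :=
    intervalIntegral.continuous_parametric_intervalIntegral_of_continuous'
      (f := fun z s => (F ∘ π) (z, s)) hc 0 1
  refine hint.continuousOn.congr fun z hz => ?_
  refine intervalIntegral.integral_congr fun s hs => ?_
  rw [uIcc_of_le zero_le_one] at hs
  simp [π, projIcc_of_mem hX hz, projIcc_of_mem zero_le_one hs]

lemma continuousOn_density_straighten {c Z X X' : ℝ} {h : ℝ × ℝ → Fin 4 → ℝ} (hc₀ : 0 < c)
    (hX' : X' ≤ depth c Z) (hh : ContinuousOn h (slab c Z X X')) :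
    ContinuousOn (fun x => density c (h (straighten c Z x))) (Icc X X' ×ˢ Icc 0 1) :=
  (density_continuous c).comp_continuousOn
    (hh.comp (straighten_continuous c Z).continuousOn (straighten_mem hc₀ hX'))

lemma lineEnergy_continuousOn {c Z X X' : ℝ} {h : ℝ × ℝ → Fin 4 → ℝ} (hc₀ : 0 < c)
    (hX' : X' ≤ depth c Z) (hh : ContinuousOn h (slab c Z X X')) :
    ContinuousOn (lineEnergy c Z h) (Icc X X') :=
  (height_continuous c Z).continuousOn.mul
    (continuousOn_integral_of_continuousOn (continuousOn_density_straighten hc₀ hX' hh))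

lemma lineEnergy_nonneg {c Z z : ℝ} (h : ℝ × ℝ → Fin 4 → ℝ) (hc₀ : 0 < c) (hc₁ : c < 1)
    (hz : z ≤ depth c Z) : 0 ≤ lineEnergy c Z h z :=
  mul_nonneg (height_nonneg hc₀ hz)
    (intervalIntegral.integral_nonneg zero_le_one fun _ _ => density_nonneg hc₀ hc₁ _)

/-- The divergence theorem for `C¹` vector fields on a closed rectangle. -/
lemma integral_divergence_rectangle {a b : ℝ} {P Q : ℝ × ℝ → ℝ} (hab : a < b)
    (hP : ContDiffOn ℝ 1 P (Icc a b ×ˢ Icc 0 1)) (hQ : ContDiffOn ℝ 1 Q (Icc a b ×ˢ Icc 0 1)) :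
    ContinuousOn (fun x => fderivWithin ℝ P (Icc a b ×ˢ Icc 0 1) x (1, 0) +
        fderivWithin ℝ Q (Icc a b ×ˢ Icc 0 1) x (0, 1)) (Icc a b ×ˢ Icc 0 1) ∧
    (∫ z in a..b, ∫ s in (0 : ℝ)..1, fderivWithin ℝ P (Icc a b ×ˢ Icc 0 1) (z, s) (1, 0) +
        fderivWithin ℝ Q (Icc a b ×ˢ Icc 0 1) (z, s) (0, 1)) =
      (((∫ z in a..b, Q (z, 1)) - ∫ z in a..b, Q (z, 0)) + ∫ s in (0 : ℝ)..1, P (b, s)) -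
        ∫ s in (0 : ℝ)..1, P (a, s) := by
  set R : Set (ℝ × ℝ) := Icc a b ×ˢ Icc 0 1 with hR
  have hu : UniqueDiffOn ℝ R := (uniqueDiffOn_Icc hab).prod (uniqueDiffOn_Icc zero_lt_one)
  have hcont : ContinuousOn (fun x => fderivWithin ℝ P R x (1, 0) + fderivWithin ℝ Q R x (0, 1)) R :=
    ((hP.continuousOn_fderivWithin hu le_rfl).clm_apply continuousOn_const).add
      ((hQ.continuousOn_fderivWithin hu le_rfl).clm_apply continuousOn_const)
  have hnhds : ∀ x ∈ Ioo a b ×ˢ Ioo (0 : ℝ) 1, R ∈ 𝓝 x := fun x hx =>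
    prod_mem_nhds (Icc_mem_nhds hx.1.1 hx.1.2) (Icc_mem_nhds hx.2.1 hx.2.2)
  have hsub : Ioo a b ×ˢ Ioo (0 : ℝ) 1 ⊆ R := prod_mono Ioo_subset_Icc_self Ioo_subset_Icc_self
  refine ⟨hcont, MeasureTheory.integral2_divergence_prod_of_hasFDerivAt P Q (fderivWithin ℝ P R)
    (fderivWithin ℝ Q R) a 0 b 1 ?_ ?_ ?_ ?_ ?_⟩
  · rw [uIcc_of_le hab.le, uIcc_of_le zero_le_one]
    exact hP.continuousOn
  · rw [uIcc_of_le hab.le, uIcc_of_le zero_le_one]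
    exact hQ.continuousOn
  · rw [min_eq_left hab.le, max_eq_right hab.le, min_eq_left zero_le_one, max_eq_right zero_le_one]
    exact fun x hx => ((hP.differentiableOn one_ne_zero) x (hsub hx)).hasFDerivWithinAt.hasFDerivAt
      (hnhds x hx)
  · rw [min_eq_left hab.le, max_eq_right hab.le, min_eq_left zero_le_one, max_eq_right zero_le_one]
    exact fun x hx => ((hQ.differentiableOn one_ne_zero) x (hsub hx)).hasFDerivWithinAt.hasFDerivAt
      (hnhds x hx)
  · rw [uIcc_of_le hab.le, uIcc_of_le zero_le_one]
    exact hcont.integrableOn_compact (isCompact_Icc.prod isCompact_Icc)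

lemma height_fst_hasFDerivAt (c Z : ℝ) (x : ℝ × ℝ) :
    HasFDerivAt (fun x : ℝ × ℝ => height c Z x.1)
      (-(1 + 1 / c) • ContinuousLinearMap.fst ℝ ℝ ℝ) x := by
  have h1 : HasDerivAt (height c Z) (-(1 / c) - 1) x.1 :=
    (((hasDerivAt_id x.1).div_const c).const_sub (2 * Z)).sub (hasDerivAt_id x.1)
  refine (h1.comp_hasFDerivAt x hasFDerivAt_fst).congr_fderiv ?_
  congr 1
  ring

lemma straighten_hasFDerivAt (c Z : ℝ) (x : ℝ × ℝ) :
    HasFDerivAt (straighten c Z) ((ContinuousLinearMap.fst ℝ ℝ ℝ).prod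
      ((1 - x.2 * (1 + 1 / c)) • ContinuousLinearMap.fst ℝ ℝ ℝ +
        height c Z x.1 • ContinuousLinearMap.snd ℝ ℝ ℝ)) x := by
  have hL : HasFDerivAt (fun x : ℝ × ℝ => height c Z x.1)
      (-(1 + 1 / c) • ContinuousLinearMap.fst ℝ ℝ ℝ) x := height_fst_hasFDerivAt c Z x
  refine HasFDerivAt.prodMk hasFDerivAt_fst ?_
  refine (hasFDerivAt_fst.add (hasFDerivAt_snd.mul hL)).congr_fderiv ?_
  ext <;> simp
  ring

/-- In the straightened coordinates the energy balance `∂_z density = ∂_t flux + supply` is a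
divergence identity. -/
lemma straightened_balance {c Z X X' : ℝ} {h : ℝ × ℝ → Fin 4 → ℝ} (hc₀ : 0 < c)
    (hX' : X' ≤ depth c Z) (hh : ContDiffOn ℝ 1 h (slab c Z X X')) {b : ℝ} (hXb : X < b)
    (hb : b ≤ X') {x : ℝ × ℝ} (hx : x ∈ Icc X b ×ˢ Icc (0 : ℝ) 1) :
    fderivWithin ℝ (fun x => height c Z x.1 * density c (h (straighten c Z x)))
        (Icc X b ×ˢ Icc 0 1) x (1, 0) +
      fderivWithin ℝ (fun x => -((1 - x.2 * (1 + 1 / c)) * density c (h (straighten c Z x)) +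
        flux c (h (straighten c Z x)))) (Icc X b ×ˢ Icc 0 1) x (0, 1) =
    height c Z x.1 * supply c (fderivWithin ℝ h (slab c Z X X') (straighten c Z x) (0, 1) -
        (matA c).mulVec (fderivWithin ℝ h (slab c Z X X') (straighten c Z x) (1, 0)))
      (h (straighten c Z x)) := by
  have hu : UniqueDiffOn ℝ (Icc X b ×ˢ Icc (0 : ℝ) 1) :=
    (uniqueDiffOn_Icc hXb).prod (uniqueDiffOn_Icc zero_lt_one)
  have hmaps : MapsTo (straighten c Z) (Icc X b ×ˢ Icc (0 : ℝ) 1) (slab c Z X X') :=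
    (straighten_mem hc₀ hX').mono_left (prod_mono_left (Icc_subset_Icc_right hb))
  set D := fderivWithin ℝ h (slab c Z X X') (straighten c Z x) with hD
  have hcomp := (hasFDerivWithinAt_slab hh (hmaps hx)).comp x
    (straighten_hasFDerivAt c Z x).hasFDerivWithinAt hmaps
  rw [← hD] at hcomp
  obtain ⟨d, hi, hdz, hds⟩ : ∃ d : Fin 4 → ℝ × ℝ →L[ℝ] ℝ,
      (∀ i, HasFDerivWithinAt (fun x => h (straighten c Z x) i) (d i)
        (Icc X b ×ˢ Icc (0 : ℝ) 1) x) ∧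
      (∀ i, d i (1, 0) = D (1, 0) i + (1 - x.2 * (1 + 1 / c)) * D (0, 1) i) ∧
      ∀ i, d i (0, 1) = height c Z x.1 * D (0, 1) i := by
    refine ⟨_, hasFDerivWithinAt_pi'.1 hcomp, fun i => ?_, fun i => ?_⟩
    · have e1 : D (1, 1 - x.2 * (1 + 1 / c)) = D (1, 0) + (1 - x.2 * (1 + 1 / c)) • D (0, 1) := by
        rw [← map_smul, ← map_add]
        simp
      simpa using congrFun e1 i
    · have e2 : D (0, height c Z x.1) = height c Z x.1 • D (0, 1) := by
        rw [← map_smul]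
        simp
      simpa using congrFun e2 i
  have hL : HasFDerivWithinAt (fun x : ℝ × ℝ => height c Z x.1)
      (-(1 + 1 / c) • ContinuousLinearMap.fst ℝ ℝ ℝ) (Icc X b ×ˢ Icc (0 : ℝ) 1) x :=
    (height_fst_hasFDerivAt c Z x).hasFDerivWithinAt
  have hs : HasFDerivWithinAt (fun x : ℝ × ℝ => 1 - x.2 * (1 + 1 / c))
      (-((1 + 1 / c) • ContinuousLinearMap.snd ℝ ℝ ℝ)) (Icc X b ×ˢ Icc (0 : ℝ) 1) x :=
    ((hasFDerivAt_snd.mul_const (1 + 1 / c)).const_sub 1).hasFDerivWithinAt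
  have hsq := fun i => (hi i).pow 2
  have hN : HasFDerivWithinAt (fun x => density c (h (straighten c Z x))) _ _ _ :=
    (((hsq 0).add (hsq 1)).add ((hsq 2).const_mul c)).add
    ((hsq 3).const_mul (c * weight c))
  have hq := (((hsq 0).sub (hsq 1)).add (hsq 2)).sub ((hsq 3).const_mul (weight c))
  have hP : HasFDerivWithinAt (fun x => height c Z x.1 * density c (h (straighten c Z x)))
    _ _ _ := hL.mul hN
  have hQ : HasFDerivWithinAt (fun x => -((1 - x.2 * (1 + 1 / c)) *
    density c (h (straighten c Z x)) + flux c (h (straighten c Z x)))) _ _ _ :=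
    ((hs.mul hN).add hq).neg
  rw [hP.fderivWithin (hu x hx), hQ.fderivWithin (hu x hx)]
  simp only [add_apply, sub_apply,
    neg_apply, smul_apply, ContinuousLinearMap.coe_fst',
    ContinuousLinearMap.coe_snd', hdz, hds, smul_eq_mul, nsmul_eq_mul, Nat.cast_ofNat,
    Nat.add_one_sub_one, pow_one]
  simp only [supply, matA_mulVec, Pi.sub_apply, Matrix.cons_val]
  ring

/-! ### The energy inequality and Gronwall's inequality -/

/-- No energy enters through the upper edge. -/
lemma top_boundary {c : ℝ} (hc₀ : 0 < c) (hc₁ : c < 1) (x : Fin 4 → ℝ) :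
    0 ≤ -((1 - 1 * (1 + 1 / c)) * density c x + flux c x) := by
  have hε := weight_pos hc₀ hc₁
  have h1 : 1 ≤ 1 / c := by rw [le_div_iff₀ hc₀]; linarith
  have e : -((1 - 1 * (1 + 1 / c)) * density c x + flux c x) =
      (1 / c - 1) * x 0 ^ 2 + (1 / c + 1) * x 1 ^ 2 + 2 * weight c * x 3 ^ 2 := by
    unfold density flux
    field_simp
    ring
  rw [e]
  have : 0 ≤ 1 / c - 1 := by linarith
  positivity

/-- The choice of `weight` makes the diagonal dissipate, and it dissipates at least the square of
the third component. -/
lemma diag_boundary {c : ℝ} (hc₀ : 0 < c) (hc₁ : c < 1) {x : Fin 4 → ℝ}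
    (hx : x 2 = (c - 1) ^ 2 / (c + 1) ^ 2 * x 3) :
    x 2 ^ 2 ≤ (1 - 0 * (1 + 1 / c)) * density c x + flux c x := by
  have h1 : 1 - c ≠ 0 := by linarith
  have h2 : c - 1 ≠ 0 := by linarith
  have e : (1 - 0 * (1 + 1 / c)) * density c x + flux c x = x 2 ^ 2 + 2 * x 0 ^ 2 := by
    have h3 : x 3 = reflection c * x 2 := by
      rw [hx, ← mul_assoc, reflection_mul_ratio hc₀ hc₁, one_mul]
    unfold density flux
    rw [h3]
    unfold reflection weight
    field_simp
    ring
  rw [e]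
  nlinarith [sq_nonneg (x 0)]

/-- The energy inequality: the divergence theorem in the straightened coordinates, with the signs of
the fluxes through the upper edge and the diagonal. The field `g` allows for sources. -/
theorem energy_le {c Z X X' : ℝ} {h g : ℝ × ℝ → Fin 4 → ℝ} {k ρ : ℝ → ℝ} (hc₀ : 0 < c)
    (hc₁ : c < 1) (hX' : X' ≤ depth c Z) (hh : ContDiffOn ℝ 1 h (slab c Z X X'))
    (hdiag : ∀ z ∈ Icc X X', h (z, z) 2 = (c - 1) ^ 2 / (c + 1) ^ 2 * h (z, z) 3)
    (hg : ContinuousOn g (slab c Z X X')) (hk : ContinuousOn k (Icc X X'))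
    (hρ : ContinuousOn ρ (Icc X X'))
    (hsupply : ∀ p ∈ slab c Z X X', supply c (fderivWithin ℝ h (slab c Z X X') p (0, 1) -
      (matA c).mulVec (fderivWithin ℝ h (slab c Z X X') p (1, 0))) (h p) ≤
        k p.1 * density c (h p) + ρ p.1 * density c (g p))
    {b : ℝ} (hb : b ∈ Icc X X') :
    lineEnergy c Z h b + ∫ z in X..b, h (z, z) 2 ^ 2 ≤ lineEnergy c Z h X +
      ∫ z in X..b, (k z * lineEnergy c Z h z + ρ z * lineEnergy c Z g z) := by
  rcases hb.1.eq_or_lt with rfl | hXb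
  · simp
  set R : Set (ℝ × ℝ) := Icc X b ×ˢ Icc 0 1 with hR
  have hIb : Icc X b ⊆ Icc X X' := Icc_subset_Icc_right hb.2
  have hmaps : MapsTo (straighten c Z) R (slab c Z X X') :=
    (straighten_mem hc₀ hX').mono_left (prod_mono_left hIb)
  have hu : ContDiffOn ℝ 1 (fun x => h (straighten c Z x)) R := by
    refine hh.comp (ContDiff.contDiffOn ?_) hmaps
    unfold straighten height
    fun_prop
  have hu2 := contDiffOn_pi.1 hu 2
  have hH : ContDiffOn ℝ 1 (fun x : ℝ × ℝ => height c Z x.1) R := by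
    unfold height
    fun_prop
  have hN : ContDiffOn ℝ 1 (fun x => density c (h (straighten c Z x))) R := by
    refine ContDiff.comp_contDiffOn (g := density c) ?_ hu
    unfold density
    fun_prop
  have hq : ContDiffOn ℝ 1 (fun x => flux c (h (straighten c Z x))) R := by
    refine ContDiff.comp_contDiffOn (g := flux c) ?_ hu
    unfold flux
    fun_prop
  have hP : ContDiffOn ℝ 1 (fun x => height c Z x.1 * density c (h (straighten c Z x))) R :=
    hH.mul hN
  have hQ : ContDiffOn ℝ 1 (fun x => -((1 - x.2 * (1 + 1 / c)) *
      density c (h (straighten c Z x)) + flux c (h (straighten c Z x)))) R := by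
    fun_prop
  obtain ⟨hcont, hdiv⟩ := integral_divergence_rectangle hXb hP hQ
  have hE : ∀ z, ∫ s in (0 : ℝ)..1, height c Z z * density c (h (straighten c Z (z, s))) =
      lineEnergy c Z h z := fun z => by
    rw [intervalIntegral.integral_const_mul]
    rfl
  simp only [hE] at hdiv
  have hmaps1 : MapsTo (fun z : ℝ => (z, (1 : ℝ))) (Icc X b) R := fun z hz =>
    ⟨hz, zero_le_one, le_rfl⟩
  have hmaps0 : MapsTo (fun z : ℝ => (z, (0 : ℝ))) (Icc X b) R := fun z hz =>
    ⟨hz, le_rfl, zero_le_one⟩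
  have hQtop : 0 ≤ ∫ z in X..b, -((1 - (1 : ℝ) * (1 + 1 / c)) *
      density c (h (straighten c Z (z, 1))) + flux c (h (straighten c Z (z, 1)))) :=
    intervalIntegral.integral_nonneg hXb.le fun z _ => top_boundary hc₀ hc₁ _
  have hst0 : ∀ z, straighten c Z (z, 0) = (z, z) := fun z => by simp [straighten]
  have hQdiag : ∫ z in X..b, h (z, z) 2 ^ 2 ≤ -∫ z in X..b, -((1 - (0 : ℝ) * (1 + 1 / c)) *
      density c (h (straighten c Z (z, 0))) + flux c (h (straighten c Z (z, 0)))) := by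
    rw [← intervalIntegral.integral_neg]
    simp only [neg_neg]
    refine intervalIntegral.integral_mono_on hXb.le ?_ ?_ fun z hz => ?_
    · refine ContinuousOn.intervalIntegrable_of_Icc hXb.le ?_
      have := (hu2.continuousOn.comp (by fun_prop) hmaps0).pow 2
      refine this.congr fun z hz => ?_
      simp [hst0]
    · refine ContinuousOn.intervalIntegrable_of_Icc hXb.le ?_
      have := (hQ.continuousOn.comp (by fun_prop) hmaps0).neg
      refine this.congr fun z hz => ?_
      simp
    · rw [hst0]
      exact diag_boundary hc₀ hc₁ (hdiag z (hIb hz))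
  have hcontN : ContinuousOn (fun x => density c (h (straighten c Z x))) R := hN.continuousOn
  have hcontG : ContinuousOn (fun x => density c (g (straighten c Z x))) R :=
    (density_continuous c).comp_continuousOn
      (hg.comp (straighten_continuous c Z).continuousOn hmaps)
  have hslice : ∀ z ∈ Icc X b, MapsTo (fun s : ℝ => (z, s)) (Icc 0 1) R := fun z hz s hs => ⟨hz, hs⟩
  have hbulk : (∫ z in X..b, ∫ s in (0 : ℝ)..1,
      fderivWithin ℝ (fun x => height c Z x.1 * density c (h (straighten c Z x))) R (z, s) (1, 0) +
      fderivWithin ℝ (fun x => -((1 - x.2 * (1 + 1 / c)) * density c (h (straighten c Z x)) +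
        flux c (h (straighten c Z x)))) R (z, s) (0, 1)) ≤
      ∫ z in X..b, (k z * lineEnergy c Z h z + ρ z * lineEnergy c Z g z) := by
    refine intervalIntegral.integral_mono_on hXb.le ?_ ?_ fun z hz => ?_
    · exact ContinuousOn.intervalIntegrable_of_Icc hXb.le
        (continuousOn_integral_of_continuousOn hcont)
    · exact ContinuousOn.intervalIntegrable_of_Icc hXb.le
        (((hk.mul (lineEnergy_continuousOn hc₀ hX' hh.continuousOn)).add
          (hρ.mul (lineEnergy_continuousOn hc₀ hX' hg))).mono hIb)
    · have hIN : IntervalIntegrable (fun s => density c (h (straighten c Z (z, s))))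
          MeasureTheory.volume 0 1 :=
        ContinuousOn.intervalIntegrable_of_Icc zero_le_one
          (hcontN.comp (by fun_prop) (hslice z hz))
      have hIG : IntervalIntegrable (fun s => density c (g (straighten c Z (z, s))))
          MeasureTheory.volume 0 1 :=
        ContinuousOn.intervalIntegrable_of_Icc zero_le_one
          (hcontG.comp (by fun_prop) (hslice z hz))
      have e : k z * lineEnergy c Z h z + ρ z * lineEnergy c Z g z =
          ∫ s in (0 : ℝ)..1, (height c Z z * k z * density c (h (straighten c Z (z, s))) +
            height c Z z * ρ z * density c (g (straighten c Z (z, s)))) := by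
        rw [intervalIntegral.integral_add (hIN.const_mul _) (hIG.const_mul _),
          intervalIntegral.integral_const_mul, intervalIntegral.integral_const_mul]
        unfold lineEnergy
        ring
      rw [e]
      refine intervalIntegral.integral_mono_on zero_le_one ?_
        ((hIN.const_mul _).add (hIG.const_mul _)) fun s hs => ?_
      · exact ContinuousOn.intervalIntegrable_of_Icc zero_le_one
          (hcont.comp (by fun_prop) (hslice z hz))
      · have hx : (z, s) ∈ R := ⟨hz, hs⟩
        rw [straightened_balance hc₀ hX' hh hXb hb.2 hx]
        have h1 := hsupply _ (hmaps hx)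
        have h2 := height_nonneg hc₀ (hz.2.trans (hb.2.trans hX'))
        have h3 := mul_le_mul_of_nonneg_left h1 h2
        refine h3.trans_eq ?_
        simp only [straighten]
        ring
  linarith

/-- Gronwall's inequality in integral form, with an additional nonnegative term `D` on the left. -/
lemma integral_gronwall {X X' C : ℝ} {E D k : ℝ → ℝ} (hE : ContinuousOn E (Icc X X'))
    (hk : ContinuousOn k (Icc X X')) (hk0 : ∀ z ∈ Icc X X', 0 ≤ k z)
    (hD0 : ∀ z ∈ Icc X X', 0 ≤ D z)
    (h : ∀ z ∈ Icc X X', E z + D z ≤ C + ∫ s in X..z, k s * E s) {z : ℝ} (hz : z ∈ Icc X X') :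
    E z + D z ≤ C * Real.exp (∫ s in X..z, k s) := by
  have hX : X ≤ X' := hz.1.trans hz.2
  have hkE : ContinuousOn (fun s => k s * E s) (Icc X X') := hk.mul hE
  have hprim : ∀ g : ℝ → ℝ, ContinuousOn g (Icc X X') →
      ContinuousOn (fun z => ∫ s in X..z, g s) (Icc X X') ∧
      ∀ z ∈ Ioo X X', HasDerivAt (fun z => ∫ s in X..z, g s) (g z) z := by
    intro g hg
    refine ⟨?_, fun z hz => ?_⟩
    · have := intervalIntegral.continuousOn_primitive_interval (μ := MeasureTheory.volume) (f := g)
        (a := X) (b := X') (by rw [uIcc_of_le hX]; exact hg.integrableOn_compact isCompact_Icc)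
      rwa [uIcc_of_le hX] at this
    · exact intervalIntegral.integral_hasDerivAt_right
        ((hg.mono (Icc_subset_Icc_right hz.2.le)).intervalIntegrable_of_Icc hz.1.le)
        ((hg.mono Ioo_subset_Icc_self).stronglyMeasurableAtFilter isOpen_Ioo z hz)
        (hg.continuousAt (Icc_mem_nhds hz.1 hz.2))
  obtain ⟨hc1, hd1⟩ := hprim _ hkE
  obtain ⟨hc2, hd2⟩ := hprim _ hk
  set V : ℝ → ℝ := fun z => (C + ∫ s in X..z, k s * E s) * Real.exp (-∫ s in X..z, k s) with hV
  have hdV : ∀ z ∈ Ioo X X', HasDerivAt V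
      (k z * E z * Real.exp (-∫ s in X..z, k s) +
        (C + ∫ s in X..z, k s * E s) * (Real.exp (-∫ s in X..z, k s) * -k z)) z := fun z hz =>
    ((hd1 z hz).const_add C).mul (hd2 z hz).neg.exp
  have hanti : AntitoneOn V (Icc X X') := by
    refine antitoneOn_of_deriv_nonpos (convex_Icc X X') ?_ ?_ ?_
    · exact (continuousOn_const.add hc1).mul hc2.neg.rexp
    · rw [interior_Icc]
      exact fun z hz => (hdV z hz).differentiableAt.differentiableWithinAt
    · rw [interior_Icc]
      intro z hz
      have hz' := Ioo_subset_Icc_self hz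
      rw [(hdV z hz).deriv]
      have h1 := h z hz'
      have h2 := hD0 z hz'
      have h3 := mul_nonneg (hk0 z hz') (sub_nonneg.2 ((le_add_of_nonneg_right h2).trans h1))
      have h4 := mul_nonneg h3 (Real.exp_nonneg (-∫ s in X..z, k s))
      nlinarith
  have h1 := hanti (left_mem_Icc.2 hX) hz hz.1
  simp only [hV, intervalIntegral.integral_same, add_zero, neg_zero, Real.exp_zero, mul_one] at h1
  refine (h z hz).trans ?_
  have h2 := mul_le_mul_of_nonneg_right h1 (Real.exp_nonneg (∫ s in X..z, k s))
  rwa [mul_assoc, ← Real.exp_add, neg_add_cancel, Real.exp_zero, mul_one] at h2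

/-! ### Energy estimates for solutions and their differences -/

lemma weight_le_one {c : ℝ} (hc₀ : 0 < c) (hc₁ : c < 1) : weight c ≤ 1 := by
  unfold weight
  rw [div_le_one (by positivity)]
  have h1 : (1 - c) ^ 3 ≤ 1 := pow_le_one₀ (by linarith) (by linarith)
  have h2 : 1 ≤ (1 + c) ^ 4 := one_le_pow₀ (by linarith)
  have h3 : 0 ≤ (1 - c) ^ 3 := pow_nonneg (by linarith) 3
  nlinarith

lemma sum_sq_le_density {c : ℝ} (hc₀ : 0 < c) (hc₁ : c < 1) (x : Fin 4 → ℝ) :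
    x 0 ^ 2 + x 1 ^ 2 + x 2 ^ 2 + x 3 ^ 2 ≤ density c x / (c * weight c) := by
  have hε := weight_pos hc₀ hc₁
  have hε1 := weight_le_one hc₀ hc₁
  have h1 : c * weight c ≤ 1 := by nlinarith
  have h2 : c * weight c ≤ c := by nlinarith
  rw [le_div_iff₀ (by positivity)]
  unfold density
  nlinarith [sq_nonneg (x 0), sq_nonneg (x 1), sq_nonneg (x 2), sq_nonneg (x 3)]

/-- The coupling matrix is a contraction for the Euclidean norm. -/
lemma sum_sq_matB_le {c : ℝ} (hc₀ : 0 < c) (hc₁ : c < 1) (x : Fin 4 → ℝ) :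
    (matB c).mulVec x 0 ^ 2 + (matB c).mulVec x 1 ^ 2 + (matB c).mulVec x 2 ^ 2 +
      (matB c).mulVec x 3 ^ 2 ≤ x 0 ^ 2 + x 1 ^ 2 + x 2 ^ 2 + x 3 ^ 2 := by
  rw [matB_mulVec]
  simp only [Matrix.cons_val]
  have h : 0 ≤ (1 - c ^ 2) / 2 := by nlinarith
  have h1 := mul_nonneg h (sq_nonneg (x 0 + x 1))
  have h2 := mul_nonneg h (sq_nonneg (x 2 - x 3))
  nlinarith

lemma two_abs_mul_le {l : ℝ} (hl : 0 < l) (a b : ℝ) : 2 * |a * b| ≤ l * b ^ 2 + a ^ 2 / l := by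
  rw [abs_mul, ← sq_abs a, ← sq_abs b]
  have : l * |b| ^ 2 + |a| ^ 2 / l - 2 * (|a| * |b|) = (l * |b| - |a|) ^ 2 / l := by
    field_simp
    ring
  have h2 : 0 ≤ (l * |b| - |a|) ^ 2 / l := by positivity
  linarith

lemma supply_le {c l : ℝ} (hc₀ : 0 < c) (hc₁ : c < 1) (hl : 0 < l) (r x : Fin 4 → ℝ) :
    supply c r x ≤ l * (x 0 ^ 2 + x 1 ^ 2 + x 2 ^ 2 + x 3 ^ 2) +
      (r 0 ^ 2 + r 1 ^ 2 + r 2 ^ 2 + r 3 ^ 2) / l := by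
  have h0 := two_abs_mul_le hl (r 0) (x 0)
  have h1 := two_abs_mul_le hl (r 1) (x 1)
  have h2 := two_abs_mul_le hl (r 2) (x 2)
  have h3 := two_abs_mul_le hl (r 3) (x 3)
  have e0 := neg_abs_le (r 0 * x 0)
  have e1 := le_abs_self (r 1 * x 1)
  have e2 := neg_abs_le (r 2 * x 2)
  have e3 := le_abs_self (r 3 * x 3)
  have hε := weight_pos hc₀ hc₁
  have hε1 := weight_le_one hc₀ hc₁
  have e4 : weight c * (r 3 * x 3) ≤ |r 3 * x 3| :=
    (mul_le_mul_of_nonneg_left e3 hε.le).trans (mul_le_of_le_one_left (abs_nonneg _) hε1)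
  unfold supply
  rw [add_div, add_div, add_div]
  linarith

lemma supply_coupled_le {c k l : ℝ} (hc₀ : 0 < c) (hc₁ : c < 1) (hl : 0 < l) (x y : Fin 4 → ℝ) :
    supply c (k • (matB c).mulVec y) x ≤
      l / (c * weight c) * density c x + k ^ 2 / (l * (c * weight c)) * density c y := by
  have hε := weight_pos hc₀ hc₁
  have h1 := supply_le hc₀ hc₁ hl (k • (matB c).mulVec y) x
  have h2 := mul_le_mul_of_nonneg_left (sum_sq_le_density hc₀ hc₁ x) hl.le
  have h3 := mul_le_mul_of_nonneg_left
    ((sum_sq_matB_le hc₀ hc₁ y).trans (sum_sq_le_density hc₀ hc₁ y))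
    (div_nonneg (sq_nonneg k) hl.le)
  simp only [Pi.smul_apply, smul_eq_mul] at h1
  refine h1.trans ((add_le_add h2 (le_trans (le_of_eq ?_) h3)).trans_eq ?_)
  · ring
  · field_simp

lemma supply_add (c : ℝ) (r r' x : Fin 4 → ℝ) :
    supply c (r + r') x = supply c r x + supply c r' x := by
  simp only [supply, Pi.add_apply]
  ring

lemma supply_self_le {c k : ℝ} (hc₀ : 0 < c) (hc₁ : c < 1) (x : Fin 4 → ℝ) :
    supply c (k • (matB c).mulVec x) x ≤ 4 * |k| / (c * weight c) * density c x := by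
  have hε := weight_pos hc₀ hc₁
  have hN := density_nonneg hc₀ hc₁ x
  rcases eq_or_ne k 0 with rfl | hk
  · simp [supply]
  · have h := supply_coupled_le (k := k) hc₀ hc₁ (abs_pos.2 hk) x x
    have e : k ^ 2 / (|k| * (c * weight c)) = |k| / (c * weight c) := by
      have := abs_pos.2 hk
      rw [← sq_abs]
      field_simp
    rw [e] at h
    have : 0 ≤ |k| / (c * weight c) * density c x := by positivity
    calc _ ≤ _ := h
      _ ≤ 4 * (|k| / (c * weight c) * density c x) := by linarith
      _ = _ := by ring

/-- The Cauchy–Schwarz inequality for `f` and `1`. -/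
lemma integral_abs_le_sqrt {X X' : ℝ} {f : ℝ → ℝ} (hX : X ≤ X') (hf : ContinuousOn f (Icc X X')) :
    ∫ z in X..X', |f z| ≤ Real.sqrt ((X' - X) * normSq X X' f) := by
  rcases hX.eq_or_lt with rfl | hlt
  · simp
  have hd : 0 < X' - X := by linarith
  refine Real.le_sqrt_of_sq_le ?_
  set I := ∫ z in X..X', |f z| with hI
  have hfi : IntervalIntegrable (fun z => |f z|) MeasureTheory.volume X X' :=
    hf.abs.intervalIntegrable_of_Icc hX
  have hf2 : IntervalIntegrable (fun z => f z ^ 2) MeasureTheory.volume X X' :=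
    (hf.pow 2).intervalIntegrable_of_Icc hX
  have h0 : 0 ≤ ∫ z in X..X', (|f z| - I / (X' - X)) ^ 2 :=
    intervalIntegral.integral_nonneg hX fun _ _ => sq_nonneg _
  have e : ∫ z in X..X', (|f z| - I / (X' - X)) ^ 2 = normSq X X' f - I ^ 2 / (X' - X) := by
    have : ∀ z, (|f z| - I / (X' - X)) ^ 2 =
        (f z ^ 2 - 2 * (I / (X' - X)) * |f z|) + (I / (X' - X)) ^ 2 := fun z => by
      rw [← sq_abs (f z)]
      ring
    simp only [this]
    rw [intervalIntegral.integral_add (hf2.sub (hfi.const_mul _)) (by simp),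
      intervalIntegral.integral_sub hf2 (hfi.const_mul _),
      intervalIntegral.integral_const_mul, intervalIntegral.integral_const, ← hI]
    unfold normSq
    rw [smul_eq_mul]
    field_simp
    ring
  rw [e, sub_nonneg, div_le_iff₀ hd] at h0
  linarith

lemma normSq_nonneg {X X' : ℝ} (hX : X ≤ X') (f : ℝ → ℝ) : 0 ≤ normSq X X' f :=
  intervalIntegral.integral_nonneg hX fun _ _ => sq_nonneg _

lemma normSq_congr {X X' : ℝ} {f g : ℝ → ℝ} (hX : X ≤ X') (h : EqOn f g (Icc X X')) :
    normSq X X' f = normSq X X' g := by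
  refine intervalIntegral.integral_congr fun z hz => ?_
  rw [uIcc_of_le hX] at hz
  simp only [h hz]

lemma lineEnergy_congr {c Z z : ℝ} {h h' : ℝ × ℝ → Fin 4 → ℝ} (hc₀ : 0 < c)
    (hz : z ≤ depth c Z) (heq : ∀ t ∈ Icc z (2 * Z - z / c), h (z, t) = h' (z, t)) :
    lineEnergy c Z h z = lineEnergy c Z h' z := by
  unfold lineEnergy
  congr 1
  refine intervalIntegral.integral_congr fun s hs => ?_
  rw [uIcc_of_le zero_le_one] at hs
  have := straighten_mem (X := z) (X' := z) (Z := Z) hc₀ hz (x := (z, s)) ⟨⟨le_rfl, le_rfl⟩, hs⟩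
  simp only [straighten] at this ⊢
  rw [heq _ ⟨this.2.2.1, this.2.2.2⟩]

/-- Growth of the energy of a solution with coefficient `f`, and control of its trace on the
diagonal. -/
lemma energy_growth {c Z X X' : ℝ} {f : ℝ → ℝ} {h : ℝ × ℝ → Fin 4 → ℝ} (hc₀ : 0 < c)
    (hc₁ : c < 1) (hX' : X' ≤ depth c Z) (hf : ContinuousOn f (Icc X X'))
    (hh : ContDiffOn ℝ 1 h (slab c Z X X')) (hpde : SolvesSystem c (slab c Z X X') f h)
    (hdiag : ∀ z ∈ Icc X X', h (z, z) 2 = (c - 1) ^ 2 / (c + 1) ^ 2 * h (z, z) 3)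
    {z : ℝ} (hz : z ∈ Icc X X') :
    lineEnergy c Z h z + ∫ s in X..z, h (s, s) 2 ^ 2 ≤
      lineEnergy c Z h X * Real.exp (4 * (∫ s in X..z, |f s|) / (c * weight c)) := by
  have hε := weight_pos hc₀ hc₁
  have hk : ContinuousOn (fun z => 4 * |f z| / (c * weight c)) (Icc X X') :=
    (continuousOn_const.mul hf.abs).div_const _
  have key := integral_gronwall (C := lineEnergy c Z h X) (E := lineEnergy c Z h)
    (D := fun z => ∫ s in X..z, h (s, s) 2 ^ 2)
    (lineEnergy_continuousOn hc₀ hX' hh.continuousOn) hk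
    (fun z _ => by positivity)
    (fun z hz => intervalIntegral.integral_nonneg hz.1 fun _ _ => sq_nonneg _)
    (fun z hz => by
      have := energy_le (g := h) (ρ := fun _ => 0) hc₀ hc₁ hX' hh hdiag hh.continuousOn hk
        continuousOn_const (fun p hp => by
          rw [hpde p hp, add_sub_cancel_left, zero_mul, add_zero]
          exact supply_self_le hc₀ hc₁ _) hz
      simpa using this) hz
  refine key.trans_eq ?_
  rw [intervalIntegral.integral_div, intervalIntegral.integral_const_mul]

lemma IsSidewaysSolution.diag_contDiffOn {c Z X X' : ℝ} {a : ℝ → Fin 4 → ℝ} {f : ℝ → ℝ}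
    {h : ℝ × ℝ → Fin 4 → ℝ} (hc₀ : 0 < c) (hX' : X' ≤ depth c Z)
    (hh : IsSidewaysSolution c Z X X' a f h) (i : Fin 4) :
    ContDiffOn ℝ 1 (fun z => h (z, z) i) (Icc X X') :=
  contDiffOn_pi.1 (hh.contDiffOn.comp (f := fun z : ℝ => (z, z)) (by fun_prop)
    fun z hz => diag_mem_slab hc₀ hX' hz) i

/-- Two solutions with the same data on the side: the energy of the difference, and its trace on
the diagonal, are controlled by the difference of the coefficients. -/
lemma energy_difference {c Z X X' δ H : ℝ} {a : ℝ → Fin 4 → ℝ} {f g : ℝ → ℝ}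
    {h h' : ℝ × ℝ → Fin 4 → ℝ} (hc₀ : 0 < c) (hc₁ : c < 1) (hX : X < X')
    (hX' : X' ≤ depth c Z) (hδ : 0 < δ) (hXδ : X' - X ≤ δ) (hf : ContinuousOn f (Icc X X'))
    (hg : ContinuousOn g (Icc X X'))
    (hfL : ∫ s in X..X', |f s| ≤ c * weight c / 16)
    (hh : IsSidewaysSolution c Z X X' a f h) (hh' : IsSidewaysSolution c Z X X' a g h')
    (hH : ∀ z ∈ Icc X X', lineEnergy c Z h' z ≤ H) {z : ℝ} (hz : z ∈ Icc X X') :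
    lineEnergy c Z (h - h') z + ∫ s in X..z, (h (s, s) 2 - h' (s, s) 2) ^ 2 ≤
      4 * δ / (c * weight c) ^ 2 * H * normSq X X' (f - g) * Real.exp (1 / 2) := by
  have hε := weight_pos hc₀ hc₁
  have huniq := uniqueDiffOn_slab (Z := Z) hc₀ hX hX'
  have hH0 : 0 ≤ H := (lineEnergy_nonneg h' hc₀ hc₁ (hX.le.trans hX')).trans
    (hH X (left_mem_Icc.2 hX.le))
  set k : ℝ → ℝ := fun z => 4 * |f z| / (c * weight c) + 1 / (4 * δ) with hk
  set ρ : ℝ → ℝ := fun z => 4 * δ / (c * weight c) ^ 2 * (f z - g z) ^ 2 with hρ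
  have hkc : ContinuousOn k (Icc X X') :=
    ((continuousOn_const.mul hf.abs).div_const _).add continuousOn_const
  have hρc : ContinuousOn ρ (Icc X X') := continuousOn_const.mul ((hf.sub hg).pow 2)
  have hk0 : ∀ z, 0 ≤ k z := fun z => by positivity
  have hρ0 : ∀ z, 0 ≤ ρ z := fun z => by positivity
  have hwC : ContDiffOn ℝ 1 (h - h') (slab c Z X X') := hh.contDiffOn.sub hh'.contDiffOn
  have hwdiag : ∀ z ∈ Icc X X', (h - h') (z, z) 2 =
      (c - 1) ^ 2 / (c + 1) ^ 2 * (h - h') (z, z) 3 := fun z hz => by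
    simp only [Pi.sub_apply, hh.diag z hz, hh'.diag z hz]
    ring
  have hsupply : ∀ p ∈ slab c Z X X', supply c (fderivWithin ℝ (h - h') (slab c Z X X') p (0, 1) -
      (matA c).mulVec (fderivWithin ℝ (h - h') (slab c Z X X') p (1, 0))) ((h - h') p) ≤
        k p.1 * density c ((h - h') p) + ρ p.1 * density c (h' p) := by
    intro p hp
    have e1 : fderivWithin ℝ (h - h') (slab c Z X X') p =
        fderivWithin ℝ h (slab c Z X X') p - fderivWithin ℝ h' (slab c Z X X') p :=
      fderivWithin_sub (huniq p hp) ((hh.contDiffOn.differentiableOn one_ne_zero) p hp)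
        ((hh'.contDiffOn.differentiableOn one_ne_zero) p hp)
    have e2 : fderivWithin ℝ (h - h') (slab c Z X X') p (0, 1) -
        (matA c).mulVec (fderivWithin ℝ (h - h') (slab c Z X X') p (1, 0)) =
        f p.1 • (matB c).mulVec ((h - h') p) + (f p.1 - g p.1) • (matB c).mulVec (h' p) := by
      rw [e1]
      simp only [sub_apply, Pi.sub_apply, Matrix.mulVec_sub, hh.pde p hp, hh'.pde p hp]
      module
    rw [e2, supply_add]
    have h1 := supply_self_le (k := f p.1) hc₀ hc₁ ((h - h') p)
    -- this `l` contributes to the Gronwall rate only `1/4` over an interval of length `δ`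
    have h2 := supply_coupled_le (k := f p.1 - g p.1) (l := c * weight c / (4 * δ)) hc₀ hc₁
      (by positivity) ((h - h') p) (h' p)
    refine (add_le_add h1 h2).trans_eq ?_
    simp only [hk, hρ]
    field_simp
    ring
  have hE0 : lineEnergy c Z (h - h') X = 0 := by
    have : lineEnergy c Z (h - h') X = lineEnergy c Z 0 X :=
      lineEnergy_congr hc₀ (hX.le.trans hX') fun t ht => by
        simp [hh.side t ht, hh'.side t ht]
    rw [this]
    simp [lineEnergy, density]
  have hEc := lineEnergy_continuousOn hc₀ hX' hwC.continuousOn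
  have hEc' := lineEnergy_continuousOn hc₀ hX' hh'.contDiffOn.continuousOn
  have hmain : ∀ z ∈ Icc X X',
      lineEnergy c Z (h - h') z + ∫ s in X..z, (h (s, s) 2 - h' (s, s) 2) ^ 2 ≤
      4 * δ / (c * weight c) ^ 2 * H * normSq X X' (f - g) +
        ∫ s in X..z, k s * lineEnergy c Z (h - h') s := by
    intro z hz
    have hsub : Icc X z ⊆ Icc X X' := Icc_subset_Icc_right hz.2
    have h1 := energy_le hc₀ hc₁ hX' hwC hwdiag hh'.contDiffOn.continuousOn hkc hρc hsupply hz
    have hI1 : IntervalIntegrable (fun s => k s * lineEnergy c Z (h - h') s)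
        MeasureTheory.volume X z := ((hkc.mul hEc).mono hsub).intervalIntegrable_of_Icc hz.1
    have hI2 : IntervalIntegrable (fun s => ρ s * lineEnergy c Z h' s)
        MeasureTheory.volume X z := ((hρc.mul hEc').mono hsub).intervalIntegrable_of_Icc hz.1
    rw [hE0, zero_add, intervalIntegral.integral_add hI1 hI2] at h1
    have h2 : ∫ s in X..z, ρ s * lineEnergy c Z h' s ≤
        4 * δ / (c * weight c) ^ 2 * H * normSq X X' (f - g) := by
      have hle : ∫ s in X..z, ρ s * lineEnergy c Z h' s ≤ ∫ s in X..X', ρ s * H := by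
        calc _ ≤ ∫ s in X..z, ρ s * H :=
              intervalIntegral.integral_mono_on hz.1
                hI2
                (((hρc.mul continuousOn_const).mono hsub).intervalIntegrable_of_Icc hz.1)
                fun s hs => mul_le_mul_of_nonneg_left (hH s (hsub hs)) (hρ0 s)
          _ ≤ _ := intervalIntegral.integral_mono_interval le_rfl hz.1 hz.2
                (Eventually.of_forall fun s => mul_nonneg (hρ0 s) hH0)
                ((hρc.mul continuousOn_const).intervalIntegrable_of_Icc hX.le)
      refine hle.trans_eq ?_
      simp only [hρ]
      rw [intervalIntegral.integral_mul_const, intervalIntegral.integral_const_mul]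
      unfold normSq
      simp only [Pi.sub_apply]
      ring
    simp only [Pi.sub_apply] at h1
    linarith
  have hG := integral_gronwall hEc hkc (fun z _ => hk0 z)
    (fun z hz => intervalIntegral.integral_nonneg hz.1 fun _ _ => sq_nonneg _) hmain hz
  refine hG.trans (mul_le_mul_of_nonneg_left (Real.exp_le_exp.2 ?_) ?_)
  · have h1 : ∫ s in X..z, k s ≤ ∫ s in X..X', k s :=
      intervalIntegral.integral_mono_interval le_rfl hz.1 hz.2
        (Eventually.of_forall fun s => hk0 s) (hkc.intervalIntegrable_of_Icc hX.le)
    have h2 : ∫ s in X..X', k s = 4 * (∫ s in X..X', |f s|) / (c * weight c) +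
        (X' - X) * (1 / (4 * δ)) := by
      have hI : IntervalIntegrable (fun s => 4 * |f s| / (c * weight c)) MeasureTheory.volume X X' :=
        ((continuousOn_const.mul hf.abs).div_const _).intervalIntegrable_of_Icc hX.le
      simp only [hk]
      rw [intervalIntegral.integral_add hI intervalIntegrable_const,
        intervalIntegral.integral_div, intervalIntegral.integral_const_mul,
        intervalIntegral.integral_const, smul_eq_mul]
    have h3 : 4 * (∫ s in X..X', |f s|) / (c * weight c) ≤ 1 / 4 := by
      rw [div_le_iff₀ (by positivity)]
      linarith
    have h4 : (X' - X) * (1 / (4 * δ)) ≤ 1 / 4 := by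
      rw [mul_one_div, div_le_iff₀ (by positivity)]
      linarith
    linarith
  · have := normSq_nonneg hX.le (f - g)
    positivity

/-! ### The local iteration -/

lemma eqOn_zero_of_integral_eq_zero {a b : ℝ} {F : ℝ → ℝ} (hab : a < b)
    (hF : ContinuousOn F (Icc a b)) (h0 : ∀ x ∈ Icc a b, 0 ≤ F x) (hI : ∫ x in a..b, F x ≤ 0) :
    ∀ x ∈ Icc a b, F x = 0 := by
  intro x hx
  by_contra hne
  have := intervalIntegral.integral_pos hab hF (fun y hy => h0 y (Ioc_subset_Icc_self hy))
    ⟨x, hx, lt_of_le_of_ne (h0 x hx) (Ne.symm hne)⟩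
  linarith

/-- A continuous field without energy vanishes, also at the tip of the last slab, where the
vertical segment degenerates to a point. -/
lemma eqOn_zero_of_lineEnergy_le_zero {c Z X X' : ℝ} {w : ℝ × ℝ → Fin 4 → ℝ} (hc₀ : 0 < c)
    (hc₁ : c < 1) (hX : X < X') (hX' : X' ≤ depth c Z) (hw : ContinuousOn w (slab c Z X X'))
    (hE : ∀ z ∈ Icc X X', lineEnergy c Z w z ≤ 0) : ∀ p ∈ slab c Z X X', w p = 0 := by
  have hε := weight_pos hc₀ hc₁
  have hpos : ∀ z ∈ Icc X X', 0 < height c Z z → ∀ t ∈ Icc z (2 * Z - z / c), w (z, t) = 0 := by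
    intro z hz hh t ht
    have hmaps : MapsTo (fun s : ℝ => (z, s)) (Icc 0 1) (Icc X X' ×ˢ Icc (0 : ℝ) 1) :=
      fun s hs => ⟨hz, hs⟩
    have h0 : ∫ s in (0 : ℝ)..1, density c (w (straighten c Z (z, s))) ≤ 0 :=
      nonpos_of_mul_nonpos_right (hE z hz) hh
    have h1 := eqOn_zero_of_integral_eq_zero zero_lt_one
      ((continuousOn_density_straighten hc₀ hX' hw).comp (by fun_prop) hmaps)
      (fun _ _ => density_nonneg hc₀ hc₁ _) h0 ((t - z) / height c Z z)
      ⟨div_nonneg (by linarith [ht.1]) hh.le, by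
        rw [div_le_one hh]
        unfold height
        linarith [ht.2]⟩
    have e : straighten c Z (z, (t - z) / height c Z z) = (z, t) := by
      simp only [straighten, div_mul_cancel₀ _ hh.ne']
      ring_nf
    simp only [Function.comp_apply, e] at h1
    have h2 := sum_sq_le_density hc₀ hc₁ (w (z, t))
    rw [h1, zero_div] at h2
    ext i
    have := sq_nonneg (w (z, t) 0)
    have := sq_nonneg (w (z, t) 1)
    have := sq_nonneg (w (z, t) 2)
    have := sq_nonneg (w (z, t) 3)
    refine pow_eq_zero_iff two_ne_zero |>.1 ?_
    fin_cases i <;> simp only [Fin.zero_eta, Fin.mk_one, Fin.reduceFinMk] <;> linarith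
  rintro ⟨z, t⟩ ⟨h1, h2, h3, h4⟩
  simp only at h1 h2 h3 h4
  rcases (height_nonneg hc₀ (h2.trans hX')).lt_or_eq with hh | hh
  · exact hpos z ⟨h1, h2⟩ hh t ⟨h3, h4⟩
  · have hlt : ∀ y ∈ Ico X X', w (y, y) = 0 := fun y hy => by
      have := lt_top_of_lt_depth hc₀ (hy.2.trans_le hX')
      exact hpos y (Ico_subset_Icc_self hy) (by unfold height; linarith) y ⟨le_rfl, this.le⟩
    have hc : ContinuousOn (fun y : ℝ => w (y, y)) (Icc X X') :=
      hw.comp (by fun_prop) fun y hy => diag_mem_slab hc₀ hX' hy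
    have heq : EqOn (fun y : ℝ => w (y, y)) (fun _ => 0) (Icc X X') :=
      EqOn.of_subset_closure (s := Ico X X') hlt hc continuousOn_const Ico_subset_Icc_self
        (by rw [closure_Ico hX.ne])
    have ht : t = z := by
      unfold height at hh
      linarith
    rw [ht]
    exact heq ⟨h1, h2⟩

lemma exp_half_le_two : Real.exp (1 / 2) ≤ 2 := by
  have h := Real.add_one_le_exp (-(1 / 2))
  rw [Real.exp_neg, le_inv_comm₀ (by norm_num) (Real.exp_pos _)] at h
  exact h.trans (by norm_num)

/-- The situation on one grid interval `[X, X']`: the true field `m` and the true twist `β` are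
available there as a solution with side data `a`, the energy of `m` at `X` is at most `E`, and `κ`
and the length of the interval are related to `E` as in the algorithm. -/
structure IsStep (c Z E κ δ X X' : ℝ) (a : ℝ → Fin 4 → ℝ) (β : ℝ → ℝ) (m : ℝ × ℝ → Fin 4 → ℝ) :
    Prop where
  pos : 0 < c
  lt_one : c < 1
  lt : X < X'
  le_depth : X' ≤ depth c Z
  length_le : X' - X ≤ δ
  energy_pos : 0 < E
  radius_eq : κ = 8 * (1 + c) ^ 2 / (1 - c) ^ 2 * E
  step_eq : δ = c ^ 2 * weight c ^ 2 / (256 * κ)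
  solution : IsSidewaysSolution c Z X X' a β m
  smooth : ContDiffOn ℝ 1 β (Icc X X')
  normSq_le : normSq X X' β ≤ κ
  trace : ∀ z ∈ Icc X X', 2 * (c + 1) / (c - 1) * m (z, z) 2 = β z
  lineEnergy_le : lineEnergy c Z m X ≤ E

namespace IsStep

variable {c Z E κ δ X X' : ℝ} {a : ℝ → Fin 4 → ℝ} {β f g : ℝ → ℝ} {m h h' : ℝ × ℝ → Fin 4 → ℝ}

lemma radius_pos (S : IsStep c Z E κ δ X X' a β m) : 0 < κ := by
  have h1 := S.pos
  have h2 : 0 < 1 - c := by linarith [S.lt_one]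
  have h3 := S.energy_pos
  rw [S.radius_eq]
  positivity

lemma step_pos (S : IsStep c Z E κ δ X X' a β m) : 0 < δ := by
  have h1 := S.pos
  have h2 := weight_pos S.pos S.lt_one
  have h3 := S.radius_pos
  rw [S.step_eq]
  positivity

lemma mem_ball (S : IsStep c Z E κ δ X X' a β m) : β ∈ localBall X X' (β X) κ :=
  ⟨S.smooth, rfl, S.normSq_le⟩

/-- The step size makes the coefficients in the ball small in `L¹`. -/
lemma integral_abs_le (S : IsStep c Z E κ δ X X' a β m) (hf : f ∈ localBall X X' (β X) κ) :
    ∫ s in X..X', |f s| ≤ c * weight c / 16 := by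
  have h1 := S.pos
  have h2 := weight_pos S.pos S.lt_one
  have h3 := S.radius_pos
  have h4 := S.step_pos
  have h5 := S.lt
  refine (integral_abs_le_sqrt S.lt.le hf.1.continuousOn).trans ?_
  refine (Real.sqrt_le_sqrt (y := δ * κ)
    (mul_le_mul S.length_le hf.2.2 (normSq_nonneg S.lt.le _) h4.le)).trans_eq ?_
  have : δ * κ = (c * weight c / 16) ^ 2 := by
    rw [S.step_eq]
    field_simp
    ring
  rw [this, Real.sqrt_sq (by positivity)]

lemma exists_solution (S : IsStep c Z E κ δ X X' a β m) (hf : f ∈ localBall X X' (β X) κ) :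
    ∃ h, IsSidewaysSolution c Z X X' a f h := by
  have h1 := S.pos
  have h2 := weight_pos S.pos S.lt_one
  have h3 := weight_le_one S.pos S.lt_one
  have h4 : 0 < 1 - c := by linarith [S.lt_one]
  refine exists_sideways S.pos S.lt_one S.lt S.le_depth S.solution hf.1.continuousOn hf.2.1
    (by positivity) (S.integral_abs_le hf) ?_
  have e : (reflection c * ((1 + c) / (1 - c)) + 2) *
      ((c * weight c / 16 + c * weight c / 16) / c) = c / (8 * (1 + c)) + weight c / 4 := by
    unfold reflection weight
    field_simp
    ring
  rw [e]
  have : c / (8 * (1 + c)) ≤ 1 / 8 := by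
    rw [div_le_iff₀ (by positivity)]
    linarith
  linarith

lemma sidewaysSolution_spec (S : IsStep c Z E κ δ X X' a β m)
    (hf : f ∈ localBall X X' (β X) κ) :
    IsSidewaysSolution c Z X X' a f (sidewaysSolution c Z X X' a f) :=
  Classical.epsilon_spec (S.exists_solution hf)

lemma lineEnergy_and_trace_le (S : IsStep c Z E κ δ X X' a β m)
    (hf : f ∈ localBall X X' (β X) κ) (hh : IsSidewaysSolution c Z X X' a f h) {z : ℝ}
    (hz : z ∈ Icc X X') : lineEnergy c Z h z + ∫ s in X..z, h (s, s) 2 ^ 2 ≤ 2 * E := by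
  have h1 := S.pos
  have h2 := weight_pos S.pos S.lt_one
  have h3 := S.energy_pos
  have hEX : lineEnergy c Z h X ≤ E := by
    rw [lineEnergy_congr (h' := m) S.pos (S.lt.le.trans S.le_depth) fun t ht => by
      rw [hh.side t ht, S.solution.side t ht]]
    exact S.lineEnergy_le
  refine (energy_growth S.pos S.lt_one S.le_depth hf.1.continuousOn hh.contDiffOn hh.pde hh.diag
    hz).trans ?_
  have hI : ∫ s in X..z, |f s| ≤ c * weight c / 16 :=
    (intervalIntegral.integral_mono_interval le_rfl hz.1 hz.2
      (Eventually.of_forall fun s => abs_nonneg _)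
      (hf.1.continuousOn.abs.intervalIntegrable_of_Icc S.lt.le)).trans (S.integral_abs_le hf)
  have hexp : Real.exp (4 * (∫ s in X..z, |f s|) / (c * weight c)) ≤ 2 := by
    refine (Real.exp_le_exp.2 ?_).trans exp_half_le_two
    rw [div_le_iff₀ (by positivity)]
    have : 0 < c * weight c := by positivity
    linarith
  calc _ ≤ E * 2 := mul_le_mul hEX hexp (Real.exp_nonneg _) h3.le
    _ = 2 * E := mul_comm _ _

lemma lineEnergy_le_of_solution (S : IsStep c Z E κ δ X X' a β m)
    (hf : f ∈ localBall X X' (β X) κ) (hh : IsSidewaysSolution c Z X X' a f h) {z : ℝ}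
    (hz : z ∈ Icc X X') : lineEnergy c Z h z ≤ 2 * E := by
  have h1 := S.lineEnergy_and_trace_le hf hh hz
  have h2 : 0 ≤ ∫ s in X..z, h (s, s) 2 ^ 2 :=
    intervalIntegral.integral_nonneg hz.1 fun _ _ => sq_nonneg _
  linarith

lemma unique (S : IsStep c Z E κ δ X X' a β m) (hf : f ∈ localBall X X' (β X) κ)
    (hh : IsSidewaysSolution c Z X X' a f h) (hh' : IsSidewaysSolution c Z X X' a f h') :
    EqOn h h' (slab c Z X X') := by
  have h0 := eqOn_zero_of_lineEnergy_le_zero S.pos S.lt_one S.lt S.le_depth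
    (w := h - h') (hh.contDiffOn.continuousOn.sub hh'.contDiffOn.continuousOn) fun z hz => by
      have h1 := energy_difference S.pos S.lt_one S.lt S.le_depth S.step_pos S.length_le
        hf.1.continuousOn hf.1.continuousOn (S.integral_abs_le hf) hh hh'
        (fun z hz => S.lineEnergy_le_of_solution hf hh' hz) hz
      have h2 : 0 ≤ ∫ s in X..z, (h (s, s) 2 - h' (s, s) 2) ^ 2 :=
        intervalIntegral.integral_nonneg hz.1 fun _ _ => sq_nonneg _
      have h3 : normSq X X' (f - f) = 0 := by simp [normSq]
      rw [h3, mul_zero, zero_mul] at h1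
      linarith
  exact fun p hp => sub_eq_zero.1 (h0 p hp)

lemma updateMap_mem (S : IsStep c Z E κ δ X X' a β m) (hf : f ∈ localBall X X' (β X) κ) :
    updateMap c Z X X' a f ∈ localBall X X' (β X) κ := by
  have hh := S.sidewaysSolution_spec hf
  have h2 : 0 < 1 - c := by linarith [S.lt_one]
  have hXm := left_mem_Icc.2 S.lt.le
  refine ⟨contDiffOn_const.mul (hh.diag_contDiffOn S.pos S.le_depth 2), ?_, ?_⟩
  · have hX : X ∈ Icc X (2 * Z - X / c) := ⟨le_rfl, le_top S.pos (S.lt.le.trans S.le_depth)⟩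
    simp only [updateMap]
    rw [hh.side X hX, ← S.solution.side X hX, S.trace X hXm]
  · have h1 := S.lineEnergy_and_trace_le hf hh (right_mem_Icc.2 S.lt.le)
    have h3 := lineEnergy_nonneg (sidewaysSolution c Z X X' a f) S.pos S.lt_one S.le_depth
    have e : normSq X X' (updateMap c Z X X' a f) = 4 * (1 + c) ^ 2 / (1 - c) ^ 2 *
        ∫ s in X..X', sidewaysSolution c Z X X' a f (s, s) 2 ^ 2 := by
      unfold normSq updateMap
      rw [← intervalIntegral.integral_const_mul]
      congr 1
      ext s
      have : c - 1 ≠ 0 := by linarith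
      field_simp
      ring
    rw [e, S.radius_eq]
    calc _ ≤ 4 * (1 + c) ^ 2 / (1 - c) ^ 2 * (2 * E) :=
          mul_le_mul_of_nonneg_left (by linarith) (by positivity)
      _ = _ := by ring

lemma contraction (S : IsStep c Z E κ δ X X' a β m) (hf : f ∈ localBall X X' (β X) κ)
    (hg : g ∈ localBall X X' (β X) κ) :
    normSq X X' (updateMap c Z X X' a f - updateMap c Z X X' a g) ≤
      1 / 2 * normSq X X' (f - g) := by
  have hh := S.sidewaysSolution_spec hf
  have hh' := S.sidewaysSolution_spec hg
  have hc := S.pos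
  have hE := S.energy_pos
  have hε := weight_pos S.pos S.lt_one
  have h2 : 0 < 1 - c := by linarith [S.lt_one]
  have h1 := energy_difference S.pos S.lt_one S.lt S.le_depth S.step_pos S.length_le
    hf.1.continuousOn hg.1.continuousOn (S.integral_abs_le hf) hh hh'
    (fun z hz => S.lineEnergy_le_of_solution hg hh' hz) (right_mem_Icc.2 S.lt.le)
  have h3 := lineEnergy_nonneg (sidewaysSolution c Z X X' a f - sidewaysSolution c Z X X' a g)
    S.pos S.lt_one S.le_depth
  have hn := normSq_nonneg S.lt.le (f - g)
  have e : normSq X X' (updateMap c Z X X' a f - updateMap c Z X X' a g) =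
      4 * (1 + c) ^ 2 / (1 - c) ^ 2 * ∫ s in X..X',
        (sidewaysSolution c Z X X' a f (s, s) 2 - sidewaysSolution c Z X X' a g (s, s) 2) ^ 2 := by
    unfold normSq updateMap
    rw [← intervalIntegral.integral_const_mul]
    congr 1
    ext s
    have : c - 1 ≠ 0 := by linarith
    simp only [Pi.sub_apply]
    field_simp
    ring
  have h4 : 4 * δ / (c * weight c) ^ 2 * (2 * E) * normSq X X' (f - g) * Real.exp (1 / 2) ≤
      4 * δ / (c * weight c) ^ 2 * (2 * E) * normSq X X' (f - g) * 2 := by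
    have := S.step_pos
    exact mul_le_mul_of_nonneg_left exp_half_le_two (by positivity)
  -- inserting `δ` and `κ` turns the constant into `1/32`
  rw [e]
  calc _ ≤ 4 * (1 + c) ^ 2 / (1 - c) ^ 2 *
        (4 * δ / (c * weight c) ^ 2 * (2 * E) * normSq X X' (f - g) * 2) :=
        mul_le_mul_of_nonneg_left (by linarith) (by positivity)
    _ = 1 / 32 * normSq X X' (f - g) := by
        rw [S.step_eq, S.radius_eq]
        field_simp
        ring
    _ ≤ _ := by linarith

lemma sidewaysSolution_eqOn (S : IsStep c Z E κ δ X X' a β m) :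
    EqOn (sidewaysSolution c Z X X' a β) m (slab c Z X X') :=
  S.unique S.mem_ball (S.sidewaysSolution_spec S.mem_ball) S.solution

lemma updateMap_eqOn (S : IsStep c Z E κ δ X X' a β m) :
    EqOn (updateMap c Z X X' a β) β (Icc X X') := fun z hz => by
  simp only [updateMap]
  rw [S.sidewaysSolution_eqOn (diag_mem_slab S.pos S.le_depth hz), S.trace z hz]

lemma iterate_mem (S : IsStep c Z E κ δ X X' a β m) (hf : f ∈ localBall X X' (β X) κ) (n : ℕ) :
    (updateMap c Z X X' a)^[n] f ∈ localBall X X' (β X) κ := by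
  induction n with
  | zero => exact hf
  | succ n ih =>
    rw [Function.iterate_succ_apply']
    exact S.updateMap_mem ih

lemma iterate_dist_le (S : IsStep c Z E κ δ X X' a β m) (hf : f ∈ localBall X X' (β X) κ)
    (n : ℕ) : normSq X X' ((updateMap c Z X X' a)^[n] f - β) ≤
      (1 / 2) ^ n * normSq X X' (f - β) := by
  induction n with
  | zero => simp
  | succ n ih =>
    rw [Function.iterate_succ_apply']
    have e : normSq X X' (updateMap c Z X X' a ((updateMap c Z X X' a)^[n] f) - β) =
        normSq X X' (updateMap c Z X X' a ((updateMap c Z X X' a)^[n] f) -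
          updateMap c Z X X' a β) :=
      normSq_congr S.lt.le fun z hz => by simp only [Pi.sub_apply, S.updateMap_eqOn hz]
    rw [e, pow_succ]
    have := S.contraction (S.iterate_mem hf n) S.mem_ball
    linarith

lemma initialGuess_mem (S : IsStep c Z E κ δ X X' a β m) :
    initialGuess X (β X) κ ∈ localBall X X' (β X) κ := by
  have hκ := S.radius_pos
  set b := β X
  refine ⟨?_, by simp [initialGuess], ?_⟩
  · unfold initialGuess
    fun_prop
  · -- the square of the guess has an elementary primitive
    have hd : ∀ z ∈ uIcc X X', HasDerivAt (fun z => -κ * Real.exp (-(b ^ 2 / κ) * (z - X)))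
        (initialGuess X b κ z ^ 2) z := fun z _ => by
      have h1 : HasDerivAt (fun z => -(b ^ 2 / κ) * (z - X)) (-(b ^ 2 / κ) * 1) z :=
        ((hasDerivAt_id z).sub_const X).const_mul _
      refine (h1.exp.const_mul (-κ)).congr_deriv ?_
      have h2 : Real.exp (-(b ^ 2 / κ) * (z - X)) =
          Real.exp (-(b ^ 2 / (2 * κ)) * (z - X)) ^ 2 := by
        rw [← Real.exp_nat_mul]
        congr 1
        push_cast
        field_simp
      simp only [initialGuess]
      rw [h2]
      field_simp
    have hc : Continuous fun z => initialGuess X b κ z ^ 2 := by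
      unfold initialGuess
      fun_prop
    unfold normSq
    rw [intervalIntegral.integral_eq_sub_of_hasDerivAt hd (hc.intervalIntegrable _ _)]
    have := mul_pos hκ (Real.exp_pos (-(b ^ 2 / κ) * (X' - X)))
    simp only [sub_self, mul_zero, Real.exp_zero]
    linarith

lemma localReconstruction_spec (S : IsStep c Z E κ δ X X' a β m) :
    ContDiffOn ℝ 1 (localReconstruction c Z κ X X' a (β X)) (Icc X X') ∧
      EqOn (localReconstruction c Z κ X X' a (β X)) β (Icc X X') := by
  have hlim : Tendsto (fun n : ℕ => normSq X X'
      ((updateMap c Z X X' a)^[n] (initialGuess X (β X) κ) - β)) atTop (𝓝 0) := by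
    have hpow : Tendsto (fun n : ℕ => (1 / 2 : ℝ) ^ n *
        normSq X X' (initialGuess X (β X) κ - β)) atTop (𝓝 0) := by
      have := (tendsto_pow_atTop_nhds_zero_of_lt_one (r := (1 / 2 : ℝ)) (by norm_num)
        (by norm_num)).mul_const (normSq X X' (initialGuess X (β X) κ - β))
      rwa [zero_mul] at this
    exact squeeze_zero (fun n => normSq_nonneg S.lt.le _)
      (S.iterate_dist_le S.initialGuess_mem) hpow
  obtain ⟨hC, hlim'⟩ : ContDiffOn ℝ 1 (localReconstruction c Z κ X X' a (β X)) (Icc X X') ∧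
      Tendsto (fun n : ℕ => normSq X X' ((updateMap c Z X X' a)^[n] (initialGuess X (β X) κ) -
        localReconstruction c Z κ X X' a (β X))) atTop (𝓝 0) :=
    Classical.epsilon_spec (p := fun r : ℝ → ℝ => ContDiffOn ℝ 1 r (Icc X X') ∧
      Tendsto (fun n : ℕ => normSq X X' ((updateMap c Z X X' a)^[n] (initialGuess X (β X) κ) - r))
        atTop (𝓝 0)) ⟨β, S.smooth, hlim⟩
  refine ⟨hC, ?_⟩
  set r := localReconstruction c Z κ X X' a (β X)
  have hrc := hC.continuousOn
  have hβc := S.smooth.continuousOn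
  have hle : ∀ n : ℕ, normSq X X' (r - β) ≤
      2 * normSq X X' ((updateMap c Z X X' a)^[n] (initialGuess X (β X) κ) - r) +
        2 * normSq X X' ((updateMap c Z X X' a)^[n] (initialGuess X (β X) κ) - β) := by
    intro n
    have huc := (S.iterate_mem S.initialGuess_mem n).1.continuousOn
    set u := (updateMap c Z X X' a)^[n] (initialGuess X (β X) κ)
    have hI1 : IntervalIntegrable (fun z => (u - r) z ^ 2) MeasureTheory.volume X X' :=
      ((huc.sub hrc).pow 2).intervalIntegrable_of_Icc S.lt.le
    have hI2 : IntervalIntegrable (fun z => (u - β) z ^ 2) MeasureTheory.volume X X' :=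
      ((huc.sub hβc).pow 2).intervalIntegrable_of_Icc S.lt.le
    have hI3 : IntervalIntegrable (fun z => (r - β) z ^ 2) MeasureTheory.volume X X' :=
      ((hrc.sub hβc).pow 2).intervalIntegrable_of_Icc S.lt.le
    unfold normSq
    rw [← intervalIntegral.integral_const_mul, ← intervalIntegral.integral_const_mul,
      ← intervalIntegral.integral_add (hI1.const_mul 2) (hI2.const_mul 2)]
    refine intervalIntegral.integral_mono_on S.lt.le hI3
      ((hI1.const_mul 2).add (hI2.const_mul 2)) fun z _ => ?_
    simp only [Pi.sub_apply]
    nlinarith [sq_nonneg (u z - r z + (u z - β z))]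
  have hzero : normSq X X' (r - β) ≤ 0 := by
    have := (hlim'.const_mul 2).add (hlim.const_mul 2)
    rw [mul_zero, add_zero] at this
    exact ge_of_tendsto' this hle
  intro z hz
  have := eqOn_zero_of_integral_eq_zero S.lt ((hrc.sub hβc).pow 2)
    (fun _ _ => sq_nonneg _) hzero z hz
  exact sub_eq_zero.1 ((pow_eq_zero_iff two_ne_zero).1 this)

lemma sidewaysSolution_reconstruction_eqOn (S : IsStep c Z E κ δ X X' a β m) :
    EqOn (sidewaysSolution c Z X X' a (localReconstruction c Z κ X X' a (β X))) m
      (slab c Z X X') := by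
  obtain ⟨hC, heq⟩ := S.localReconstruction_spec
  have hmem : localReconstruction c Z κ X X' a (β X) ∈ localBall X X' (β X) κ :=
    ⟨hC, heq (left_mem_Icc.2 S.lt.le), (normSq_congr S.lt.le heq).trans_le S.normSq_le⟩
  have hm : IsSidewaysSolution c Z X X' a (localReconstruction c Z κ X X' a (β X)) m :=
    ⟨S.solution.contDiffOn, fun p hp => by rw [S.solution.pde p hp, heq ⟨hp.1, hp.2.1⟩],
      S.solution.diag, S.solution.side⟩
  exact S.unique hmem (S.sidewaysSolution_spec hmem) hm

end IsStep

/-! ### The a priori bound and the march in depth -/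

lemma depth_pos {c Z : ℝ} (hc₀ : 0 < c) (hZ : 0 < Z) : 0 < depth c Z := by
  unfold depth
  positivity

lemma depth_le {c Z : ℝ} (hc₀ : 0 < c) (hc₁ : c < 1) (hZ : 0 < Z) : depth c Z ≤ Z := by
  unfold depth
  rw [div_le_iff₀ (by linarith)]
  nlinarith

lemma slab_subset_forwardRegion {c Z X X' : ℝ} (hc₀ : 0 < c) (hc₁ : c < 1) (hX : 0 ≤ X) :
    slab c Z X X' ⊆ forwardRegion Z := by
  rintro ⟨z, t⟩ ⟨h1, -, h3, h4⟩
  simp only at h1 h3 h4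
  have h5 : z ≤ z / c := by
    rw [le_div_iff₀ hc₀]
    nlinarith
  exact ⟨hX.trans h1, h3, by simp only; linarith⟩

/-- On every slab the forward solution solves the sideways problem for the true twist. -/
lemma IsForwardSolution.isSidewaysSolution {c Z X X' : ℝ} {β : ℝ → ℝ} {m : ℝ × ℝ → Fin 4 → ℝ}
    (hc₀ : 0 < c) (hc₁ : c < 1) (hZ : 0 < Z) (hm : IsForwardSolution c Z β m) (hX : 0 ≤ X)
    (hXX' : X < X') (hX' : X' ≤ depth c Z) :
    IsSidewaysSolution c Z X X' (fun t => m (X, t)) β m where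
  contDiffOn := hm.contDiffOn.mono (slab_subset_forwardRegion hc₀ hc₁ hX)
  pde := fun p hp => by
    have hp' := slab_subset_forwardRegion hc₀ hc₁ hX hp
    rw [(((hm.contDiffOn.differentiableOn one_ne_zero) p hp').hasFDerivWithinAt.mono
      (slab_subset_forwardRegion hc₀ hc₁ hX)).fderivWithin (uniqueDiffOn_slab hc₀ hXX' hX' p hp)]
    exact hm.pde p hp'
  diag := fun z hz => by
    have hz' : z ∈ Icc 0 Z := ⟨hX.trans hz.1, hz.2.trans (hX'.trans (depth_le hc₀ hc₁ hZ))⟩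
    rw [hm.diag₃ z hz', hm.diag₄ z hz']
    have : c - 1 ≠ 0 := by linarith
    field_simp
  side := fun _ _ => rfl

/-- The energy on the side `z = 0` is the energy of the data. -/
lemma lineEnergy_zero_eq {c Z : ℝ} {β φ ψ : ℝ → ℝ} {m : ℝ × ℝ → Fin 4 → ℝ} (hZ : 0 < Z)
    (hm : IsForwardSolution c Z β m) (hφ : ∀ t ∈ Icc 0 (2 * Z), m (0, t) 0 = φ t)
    (hψ : ∀ t ∈ Icc 0 (2 * Z), m (0, t) 2 = ψ t) :
    lineEnergy c Z m 0 = ∫ t in (0 : ℝ)..2 * Z, (φ t ^ 2 + c * ψ t ^ 2) := by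
  have hh : height c Z 0 = 2 * Z := by simp [height]
  have e : ∫ s in (0 : ℝ)..1, density c (m (straighten c Z (0, s))) =
      ∫ s in (0 : ℝ)..1, (φ (s * (2 * Z)) ^ 2 + c * ψ (s * (2 * Z)) ^ 2) := by
    refine intervalIntegral.integral_congr fun s hs => ?_
    rw [uIcc_of_le zero_le_one] at hs
    have hmem : s * (2 * Z) ∈ Icc 0 (2 * Z) :=
      ⟨mul_nonneg hs.1 (by linarith), mul_le_of_le_one_left (by linarith) hs.2⟩
    simp only [straighten, hh, zero_add, density, hφ _ hmem, hψ _ hmem, hm.left₂ _ hmem,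
      hm.left₄ _ hmem]
    ring
  unfold lineEnergy
  rw [e, hh, intervalIntegral.integral_comp_mul_right
    (fun t => φ t ^ 2 + c * ψ t ^ 2) (by positivity : 2 * Z ≠ 0)]
  rw [zero_mul, one_mul, smul_eq_mul, mul_inv_cancel_left₀ (by positivity)]

lemma energyBound_pos (c Z M : ℝ) (φ ψ : ℝ → ℝ) : 0 < energyBound c Z M φ ψ :=
  mul_pos (lt_of_lt_of_le one_pos (le_max_left _ _)) (Real.exp_pos _)

lemma CDotOne.contDiffOn_depth {c Z : ℝ} {β : ℝ → ℝ} (hc₀ : 0 < c) (hc₁ : c < 1) (hZ : 0 < Z)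
    (hβ : β ∈ CDotOne Z) : ContDiffOn ℝ 1 β (Icc 0 (depth c Z)) :=
  hβ.1.mono (Icc_subset_Icc_right (depth_le hc₀ hc₁ hZ))

/-- The a priori bound: on `[0, Y]` the energy of the field, together with its trace on the
diagonal, is bounded in terms of the data and of `M`. -/
lemma forward_energy_le {c Z M : ℝ} {β φ ψ : ℝ → ℝ} {m : ℝ × ℝ → Fin 4 → ℝ} (hc₀ : 0 < c)
    (hc₁ : c < 1) (hZ : 0 < Z) (hβ : β ∈ CDotOne Z) (hm : IsForwardSolution c Z β m)
    (hφ : ∀ t ∈ Icc 0 (2 * Z), m (0, t) 0 = φ t)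
    (hψ : ∀ t ∈ Icc 0 (2 * Z), m (0, t) 2 = ψ t)
    (hM : l2Norm 0 (depth c Z) β ≤ M) {z : ℝ} (hz : z ∈ Icc 0 (depth c Z)) :
    lineEnergy c Z m z + ∫ s in (0 : ℝ)..z, m (s, s) 2 ^ 2 ≤ energyBound c Z M φ ψ := by
  have hY := depth_pos hc₀ hZ
  have hε := weight_pos hc₀ hc₁
  have hS := hm.isSidewaysSolution hc₀ hc₁ hZ le_rfl hY le_rfl
  have hβc := (CDotOne.contDiffOn_depth hc₀ hc₁ hZ hβ).continuousOn
  refine (energy_growth hc₀ hc₁ le_rfl hβc hS.contDiffOn hS.pde hS.diag hz).trans ?_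
  have hI : ∫ s in (0 : ℝ)..z, |β s| ≤ M * Real.sqrt (depth c Z) := by
    calc _ ≤ ∫ s in (0 : ℝ)..depth c Z, |β s| :=
          intervalIntegral.integral_mono_interval le_rfl hz.1 hz.2
            (Eventually.of_forall fun s => abs_nonneg _)
            (hβc.abs.intervalIntegrable_of_Icc hY.le)
      _ ≤ Real.sqrt ((depth c Z - 0) * normSq 0 (depth c Z) β) := integral_abs_le_sqrt hY.le hβc
      _ = l2Norm 0 (depth c Z) β * Real.sqrt (depth c Z) := by
          rw [sub_zero, Real.sqrt_mul hY.le, mul_comm]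
          rfl
      _ ≤ _ := mul_le_mul_of_nonneg_right hM (Real.sqrt_nonneg _)
  unfold energyBound
  refine mul_le_mul ?_ (Real.exp_le_exp.2 ?_) (Real.exp_nonneg _)
    (zero_le_one.trans (le_max_left _ _))
  · rw [lineEnergy_zero_eq hZ hm hφ hψ]
    exact le_max_right _ _
  · gcongr

lemma forward_trace {c Z z : ℝ} {β : ℝ → ℝ} {m : ℝ × ℝ → Fin 4 → ℝ} (hc₀ : 0 < c) (hc₁ : c < 1)
    (hm : IsForwardSolution c Z β m) (hz : z ∈ Icc 0 Z) :
    2 * (c + 1) / (c - 1) * m (z, z) 2 = β z := by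
  have : c - 1 ≠ 0 := by linarith
  rw [hm.diag₃ z hz]
  field_simp

/-- The twist is a multiple of the trace of `m₃`, so the a priori bound puts it into the ball. -/
lemma normSq_twist_le {c Z M X X' : ℝ} {β φ ψ : ℝ → ℝ} {m : ℝ × ℝ → Fin 4 → ℝ} (hc₀ : 0 < c)
    (hc₁ : c < 1) (hZ : 0 < Z) (hβ : β ∈ CDotOne Z) (hm : IsForwardSolution c Z β m)
    (hφ : ∀ t ∈ Icc 0 (2 * Z), m (0, t) 0 = φ t)
    (hψ : ∀ t ∈ Icc 0 (2 * Z), m (0, t) 2 = ψ t)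
    (hM : l2Norm 0 (depth c Z) β ≤ M) (hX : 0 ≤ X) (hXX' : X ≤ X') (hX' : X' ≤ depth c Z) :
    normSq X X' β ≤ radius c Z M φ ψ := by
  have hY := depth_pos hc₀ hZ
  have hE := energyBound_pos c Z M φ ψ
  have h1 := forward_energy_le hc₀ hc₁ hZ hβ hm hφ hψ hM (right_mem_Icc.2 hY.le)
  have h2 := lineEnergy_nonneg m hc₀ hc₁ (le_refl (depth c Z))
  have hβc := (CDotOne.contDiffOn_depth hc₀ hc₁ hZ hβ).continuousOn
  have h3 : normSq X X' β ≤ normSq 0 (depth c Z) β :=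
    intervalIntegral.integral_mono_interval hX hXX' hX'
      (Eventually.of_forall fun _ => sq_nonneg _)
      ((hβc.pow 2).intervalIntegrable_of_Icc hY.le)
  have e : normSq 0 (depth c Z) β = 4 * (1 + c) ^ 2 / (1 - c) ^ 2 *
      ∫ s in (0 : ℝ)..depth c Z, m (s, s) 2 ^ 2 := by
    unfold normSq
    rw [← intervalIntegral.integral_const_mul]
    refine intervalIntegral.integral_congr fun s hs => ?_
    rw [uIcc_of_le hY.le] at hs
    have h1c : 1 - c ≠ 0 := by linarith
    have hc1 : c - 1 ≠ 0 := by linarith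
    simp only [← forward_trace hc₀ hc₁ hm ⟨hs.1, hs.2.trans (depth_le hc₀ hc₁ hZ)⟩]
    field_simp
    ring
  rw [e] at h3
  refine h3.trans ?_
  unfold radius
  have h4 : 0 ≤ 4 * (1 + c) ^ 2 / (1 - c) ^ 2 := by positivity
  calc _ ≤ 4 * (1 + c) ^ 2 / (1 - c) ^ 2 * (2 * energyBound c Z M φ ψ) :=
        mul_le_mul_of_nonneg_left (by linarith) h4
    _ = _ := by ring

lemma grid_zero {c Z : ℝ} (δ : ℝ) (hc₀ : 0 < c) (hZ : 0 < Z) : grid c Z δ 0 = 0 := by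
  simp [grid, (depth_pos hc₀ hZ).le]

lemma grid_nonneg {c Z δ : ℝ} (hc₀ : 0 < c) (hZ : 0 < Z) (hδ : 0 < δ) (j : ℕ) :
    0 ≤ grid c Z δ j :=
  le_min (by positivity) (depth_pos hc₀ hZ).le

lemma mul_lt_depth {c Z δ : ℝ} (hδ : 0 < δ) {j : ℕ} (hj : j < ⌈depth c Z / δ⌉₊) :
    j * δ < depth c Z := by
  rwa [Nat.lt_ceil, lt_div_iff₀ hδ] at hj

lemma grid_eq {c Z δ : ℝ} (hδ : 0 < δ) {j : ℕ} (hj : j < ⌈depth c Z / δ⌉₊) :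
    grid c Z δ j = j * δ :=
  min_eq_left (mul_lt_depth hδ hj).le

lemma grid_ceil {c Z δ : ℝ} (hδ : 0 < δ) : grid c Z δ ⌈depth c Z / δ⌉₊ = depth c Z := by
  refine min_eq_right ?_
  rw [← div_le_iff₀ hδ]
  exact Nat.le_ceil _

lemma grid_lt_succ {c Z δ : ℝ} (hδ : 0 < δ) {j : ℕ} (hj : j < ⌈depth c Z / δ⌉₊) :
    grid c Z δ j < grid c Z δ (j + 1) := by
  rw [grid_eq hδ hj]
  refine lt_min ?_ (mul_lt_depth hδ hj)
  push_cast
  linarith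

lemma grid_succ_sub_le {c Z δ : ℝ} (hδ : 0 < δ) {j : ℕ} (hj : j < ⌈depth c Z / δ⌉₊) :
    grid c Z δ (j + 1) - grid c Z δ j ≤ δ := by
  rw [grid_eq hδ hj]
  have : grid c Z δ (j + 1) ≤ ((j + 1 : ℕ) : ℝ) * δ := min_le_left _ _
  push_cast at this
  linarith

lemma stepSize_pos {c Z M : ℝ} {φ ψ : ℝ → ℝ} (hc₀ : 0 < c) (hc₁ : c < 1) :
    0 < stepSize c Z M φ ψ := by
  have h1 := weight_pos hc₀ hc₁
  have h2 := energyBound_pos c Z M φ ψ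
  have h3 : 0 < 1 - c := by linarith
  unfold stepSize radius
  positivity

/-- If the side data on the `j`-th grid interval are the true ones, then the local analysis applies
there. -/
lemma isStep_grid {c Z M δ κ : ℝ} {β φ ψ : ℝ → ℝ} {m : ℝ × ℝ → Fin 4 → ℝ} (hc₀ : 0 < c)
    (hc₁ : c < 1) (hZ : 0 < Z) (hβ : β ∈ CDotOne Z) (hm : IsForwardSolution c Z β m)
    (hφ : ∀ t ∈ Icc 0 (2 * Z), m (0, t) 0 = φ t)
    (hψ : ∀ t ∈ Icc 0 (2 * Z), m (0, t) 2 = ψ t)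
    (hM : l2Norm 0 (depth c Z) β ≤ M) (hδ : δ = stepSize c Z M φ ψ) (hκ : κ = radius c Z M φ ψ)
    {j : ℕ} (hj : j < ⌈depth c Z / δ⌉₊) {a : ℝ → Fin 4 → ℝ}
    (ha : ∀ t ∈ Icc (grid c Z δ j) (2 * Z - grid c Z δ j / c), a t = m (grid c Z δ j, t)) :
    IsStep c Z (energyBound c Z M φ ψ) κ δ (grid c Z δ j) (grid c Z δ (j + 1)) a β m := by
  have hδ0 : 0 < δ := hδ ▸ stepSize_pos hc₀ hc₁
  have h0 := grid_nonneg hc₀ hZ hδ0 j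
  have hlt := grid_lt_succ hδ0 hj
  have hY : grid c Z δ (j + 1) ≤ depth c Z := min_le_right _ _
  have hS := hm.isSidewaysSolution hc₀ hc₁ hZ h0 hlt hY
  have hsub : Icc (grid c Z δ j) (grid c Z δ (j + 1)) ⊆ Icc 0 (depth c Z) := Icc_subset_Icc h0 hY
  refine ⟨hc₀, hc₁, hlt, hY, grid_succ_sub_le hδ0 hj, energyBound_pos _ _ _ _ _, hκ,
    by rw [hδ, hκ]; rfl, ⟨hS.contDiffOn, hS.pde, hS.diag, fun t ht => (ha t ht).symm⟩,
    (CDotOne.contDiffOn_depth hc₀ hc₁ hZ hβ).mono hsub, ?_, fun z hz => ?_, ?_⟩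
  · rw [hκ]
    exact normSq_twist_le hc₀ hc₁ hZ hβ hm hφ hψ hM h0 hlt.le hY
  · have hz' := hsub hz
    exact forward_trace hc₀ hc₁ hm ⟨hz'.1, hz'.2.trans (depth_le hc₀ hc₁ hZ)⟩
  · have h1 := forward_energy_le hc₀ hc₁ hZ hβ hm hφ hψ hM ⟨h0, hlt.le.trans hY⟩
    have h2 : 0 ≤ ∫ s in (0 : ℝ)..grid c Z δ j, m (s, s) 2 ^ 2 :=
      intervalIntegral.integral_nonneg h0 fun _ _ => sq_nonneg _
    linarith

/-- The marching computes the true side data and the true twist at all grid points. -/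
lemma stage_correct {c Z M δ κ : ℝ} {β φ ψ : ℝ → ℝ} {m : ℝ × ℝ → Fin 4 → ℝ} (hc₀ : 0 < c)
    (hc₁ : c < 1) (hZ : 0 < Z) (hβ : β ∈ CDotOne Z) (hm : IsForwardSolution c Z β m)
    (hφ : ∀ t ∈ Icc 0 (2 * Z), m (0, t) 0 = φ t)
    (hψ : ∀ t ∈ Icc 0 (2 * Z), m (0, t) 2 = ψ t)
    (hM : l2Norm 0 (depth c Z) β ≤ M) (hδ : δ = stepSize c Z M φ ψ) (hκ : κ = radius c Z M φ ψ)
    (j : ℕ) (hj : j ≤ ⌈depth c Z / δ⌉₊) :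
    (∀ t ∈ Icc (grid c Z δ j) (2 * Z - grid c Z δ j / c),
      (stage c Z δ κ φ ψ j).1 t = m (grid c Z δ j, t)) ∧
    (stage c Z δ κ φ ψ j).2 = β (grid c Z δ j) := by
  induction j with
  | zero =>
    rw [grid_zero δ hc₀ hZ]
    refine ⟨fun t ht => ?_, hβ.2.1.symm⟩
    rw [zero_div, sub_zero] at ht
    ext i
    fin_cases i
    · exact (hφ t ht).symm
    · exact (hm.left₂ t ht).symm
    · exact (hψ t ht).symm
    · exact (hm.left₄ t ht).symm
  | succ j ih =>
    obtain ⟨ha, hb⟩ := ih (by omega)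
    have S := isStep_grid hc₀ hc₁ hZ hβ hm hφ hψ hM hδ hκ (by omega) ha
    have hr := right_mem_Icc.2 S.lt.le
    simp only [stage]
    rw [hb]
    exact ⟨fun t ht => S.sidewaysSolution_reconstruction_eqOn (side_mem_slab hr ht),
      S.localReconstruction_spec.2 hr⟩

/-- The interval whose piece `reconstruction` evaluates at `z` contains `z`. At `z = 0` the truncated
subtraction selects the first interval. -/
lemma mem_grid_interval {c Z δ z : ℝ} (hc₀ : 0 < c) (hZ : 0 < Z) (hδ : 0 < δ)
    (hz : z ∈ Icc 0 (depth c Z)) :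
    ⌈z / δ⌉₊ - 1 < ⌈depth c Z / δ⌉₊ ∧
      z ∈ Icc (grid c Z δ (⌈z / δ⌉₊ - 1)) (grid c Z δ (⌈z / δ⌉₊ - 1 + 1)) := by
  have hN : 0 < ⌈depth c Z / δ⌉₊ := Nat.ceil_pos.2 (div_pos (depth_pos hc₀ hZ) hδ)
  rcases hz.1.eq_or_lt with rfl | hz0
  · have h1 := grid_lt_succ (c := c) (Z := Z) hδ hN
    simp only [zero_div, Nat.ceil_zero, zero_tsub, zero_add] at h1 ⊢
    exact ⟨hN, (grid_zero δ hc₀ hZ).le, (grid_zero δ hc₀ hZ).symm.le.trans h1.le⟩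
  · have hk : 0 < ⌈z / δ⌉₊ := Nat.ceil_pos.2 (div_pos hz0 hδ)
    have hle : ⌈z / δ⌉₊ ≤ ⌈depth c Z / δ⌉₊ := Nat.ceil_mono (by gcongr; exact hz.2)
    have hlt : ⌈z / δ⌉₊ - 1 < ⌈depth c Z / δ⌉₊ := by omega
    refine ⟨hlt, ?_, ?_⟩
    · rw [grid_eq hδ hlt]
      have : ⌈z / δ⌉₊ - 1 < ⌈z / δ⌉₊ := by omega
      rw [Nat.lt_ceil, lt_div_iff₀ hδ] at this
      exact this.le
    · rw [Nat.sub_add_cancel hk]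
      refine le_min ?_ hz.2
      rw [← div_le_iff₀ hδ]
      exact Nat.le_ceil _

end TwistRecon

/-! ### Correctness of the reconstruction -/

theorem theorem1p3 (c Z M : ℝ) (hc₀ : 0 < c) (hc₁ : c < 1) (hZ : 0 < Z)
    (β : ℝ → ℝ) (hβ : β ∈ CDotOne Z)
    (m : ℝ × ℝ → Fin 4 → ℝ) (hm : IsForwardSolution c Z β m)
    (φ ψ : ℝ → ℝ)
    (hφ : ∀ t ∈ Icc 0 (2 * Z), m (0, t) 0 = φ t)
    (hψ : ∀ t ∈ Icc 0 (2 * Z), m (0, t) 2 = ψ t)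
    (hM : l2Norm 0 (depth c Z) β ≤ M)
    (δ κ : ℝ) (hδ : δ = stepSize c Z M φ ψ) (hκ : κ = radius c Z M φ ψ)
    (X : ℕ → ℝ) (hX : X = grid c Z δ)
    (a : ℕ → ℝ → Fin 4 → ℝ) (ha : a = fun j => (stage c Z δ κ φ ψ j).1)
    (b : ℕ → ℝ) (hb : b = fun j => (stage c Z δ κ φ ψ j).2)
    (Q : ℕ → (ℝ → ℝ) → ℝ → ℝ) (hQ : Q = fun j => updateMap c Z (X j) (X (j + 1)) (a j)) :
    -- the step size is positive, and finitely many steps reach the depth `Y`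
    0 < δ ∧ X 0 = 0 ∧ X ⌈depth c Z / δ⌉₊ = depth c Z ∧
    (∀ j < ⌈depth c Z / δ⌉₊,
      -- the computed Cauchy data and twist value at `X j` are the true ones
      X j < X (j + 1) ∧
      (∀ t ∈ Icc (X j) (2 * Z - X j / c), a j t = m (X j, t)) ∧
      b j = β (X j) ∧
      -- every evaluation of `Q j` on the ball is a uniquely solvable linear problem, and `Q j` is a
      -- contraction of the ball
      (∀ f ∈ localBall (X j) (X (j + 1)) (b j) κ,
        (∃ h, IsSidewaysSolution c Z (X j) (X (j + 1)) (a j) f h) ∧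
        (∀ h h', IsSidewaysSolution c Z (X j) (X (j + 1)) (a j) f h →
          IsSidewaysSolution c Z (X j) (X (j + 1)) (a j) f h' →
          EqOn h h' (slab c Z (X j) (X (j + 1)))) ∧
        Q j f ∈ localBall (X j) (X (j + 1)) (b j) κ) ∧
      (∀ f ∈ localBall (X j) (X (j + 1)) (b j) κ, ∀ g ∈ localBall (X j) (X (j + 1)) (b j) κ,
        normSq (X j) (X (j + 1)) (Q j f - Q j g) ≤ 1 / 2 * normSq (X j) (X (j + 1)) (f - g)) ∧
      -- the twist is its fixed point, and the iterates converge to it from every starting function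
      β ∈ localBall (X j) (X (j + 1)) (b j) κ ∧
      EqOn (Q j β) β (Icc (X j) (X (j + 1))) ∧
      (∀ f ∈ localBall (X j) (X (j + 1)) (b j) κ, ∀ n : ℕ,
        normSq (X j) (X (j + 1)) ((Q j)^[n] f - β) ≤
          (1 / 2) ^ n * normSq (X j) (X (j + 1)) (f - β)) ∧
      initialGuess (X j) (b j) κ ∈ localBall (X j) (X (j + 1)) (b j) κ ∧
      -- the step recovers the twist and the wave field on the slab
      EqOn (piece c Z δ κ φ ψ j) β (Icc (X j) (X (j + 1))) ∧
      EqOn (sidewaysSolution c Z (X j) (X (j + 1)) (a j) (piece c Z δ κ φ ψ j)) m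
        (slab c Z (X j) (X (j + 1)))) ∧
    -- the output of the whole procedure, computed from `c`, `Z`, `M`, `φ`, `ψ` alone, is the twist
    EqOn (reconstruction c Z δ κ φ ψ) β (Icc 0 (depth c Z)) := by
  subst hX ha hb hQ
  have hδ0 : 0 < δ := hδ ▸ stepSize_pos hc₀ hc₁
  have hstage := stage_correct hc₀ hc₁ hZ hβ hm hφ hψ hM hδ hκ
  have hstep : ∀ j < ⌈depth c Z / δ⌉₊, IsStep c Z (energyBound c Z M φ ψ) κ δ (grid c Z δ j)
      (grid c Z δ (j + 1)) (stage c Z δ κ φ ψ j).1 β m := fun j hj =>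
    isStep_grid hc₀ hc₁ hZ hβ hm hφ hψ hM hδ hκ hj (hstage j hj.le).1
  have hpiece : ∀ j < ⌈depth c Z / δ⌉₊,
      EqOn (piece c Z δ κ φ ψ j) β (Icc (grid c Z δ j) (grid c Z δ (j + 1))) := by
    intro j hj
    unfold piece
    rw [(hstage j hj.le).2]
    exact (hstep j hj).localReconstruction_spec.2
  refine ⟨hδ0, grid_zero δ hc₀ hZ, grid_ceil hδ0, fun j hj => ?_, fun z hz => ?_⟩
  · have S := hstep j hj
    have hb := (hstage j hj.le).2
    simp only [hb]
    refine ⟨S.lt, (hstage j hj.le).1, trivial,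
      fun f hf => ⟨S.exists_solution hf, fun h h' hh hh' => S.unique hf hh hh', S.updateMap_mem hf⟩,
      fun f hf g hg => S.contraction hf hg, S.mem_ball, S.updateMap_eqOn,
      fun f hf n => S.iterate_dist_le hf n, S.initialGuess_mem, hpiece j hj, ?_⟩
    unfold piece
    rw [hb]
    exact S.sidewaysSolution_reconstruction_eqOn
  · obtain ⟨hj, hzj⟩ := mem_grid_interval hc₀ hZ hδ0 hz
    exact hpiece _ hj hzj
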